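/- Let $D\in\mathbb N$, let $\mathcal X=[\underline x_1,\overline x_1]\times\dots\times[\underline x_D,\overline x_D]\subset\mathbb R^D$ with $\underline x_i<\overline x_i$, let $\varrho\in(1,\infty)^D$, and let $N_1,\dots,N_D\ge 1$ be integers. *Bernstein ellipses.* Let $B([-1,1],\varrho_i)\subset\mathbb C$ be the open ellipse with foci $\pm1$ whose semi-axes sum to $\varrho_i$. Put $\tau_i(z)=\overline x_i+\frac{\underline x_i-\overline x_i}{2}(1-z)$ and $B(\mathcal X,\varrho)=\prod_{i=1}^D\tau_i\big(B([-1,1],\varrho_i)\big)\subset\mathbb C^D$. *Tensorized Chebyshev interpolation.* Let $J=\{j\in\mathbb N_0^D: j_i\le N_i \text{ for all } i\}$ and let $T_n$ be the $n$-th Chebyshev polynomial. For $g:[-1,1]^D\to\mathbb R$ let $$I_{\overline N}(g)(y)=\sum_{j\in J}c_j\prod_{i=1}^D T_{j_i}(y_i),\qquad c_j=\Big(\prod_{i=1}^D\frac{2^{\mathbf 1_{\{0<j_i<N_i\}}}}{N_i}\Big)\sum_{k_1=0}^{N_1}{}^{''}\cdots\sum_{k_D=0}^{N_D}{}^{''}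 g\Big(\cos\tfrac{\pi k_1}{N_1},\dots,\cos\tfrac{\pi k_D}{N_D}\Big)\prod_{i=1}^D\cos\Big(j_i\pi\frac{k_i}{N_i}\Big),$$ where $\sum''$ means that the first and the last summand are halved. For $f:\mathcal X\to\mathbb R$ let $I_{\overline N}(f)(x)=I_{\overline N}(f\circ\tau)(\tau^{-1}(x))$ with $\tau=(\tau_1,\dots,\tau_D):[-1,1]^D\to\mathcal X$. **Theorem.** Let $f:\mathcal X\to\mathbb R$ have an analytic extension, again denoted by $f$, to $B(\mathcal X,\varrho)$ with $|f(z)|\le V<\infty$ for all $z\in B(\mathcal X,\varrho)$. Then the maximum of $|f-I_{\overline N}(f)|$ over $\mathcal X$ exists and $$\max_{x\in\mathcal X}\big|f(x)-I_{\overline N}(f)(x)\big|\le\min\{a(\varrho,N,D),\,b(\varrho,N,D)\},$$ where, with $S_D$ the symmetric group on $D$ elements, $$a(\varrho,N,D)=\min_{\sigma\in S_D}\left[\sum_{i=1}^D4V\frac{\varrho_{\sigma(i)}^{-N_{\sigma(i)}}}{\varrho_{\sigma(i)}-1}+\sum_{k=2}^D4V\frac{\varrho_{\sigma(k)}^{-N_{\sigma(k)}}}{\varrho_{\sigma(k)}-1}\cdot2^{k-1}\,\frac{(k-1)+2^{k-1}-1}{\prod_{j=1}^{k-1}\big(1-\frac1{\varrho_{\sigma(j)}}\big)}\right],$$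 $$b(\varrho,N,D)=2^{\frac D2+1}\,V\left(\sum_{i=1}^D\varrho_i^{-2N_i}\prod_{j=1}^D\frac1{1-\varrho_j^{-2}}\right)^{1/2}.$$ -/

import Mathlib

open scoped BigOperators

noncomputable section

namespace ChebInterp

/-- The open Bernstein ellipse `B([-1,1], ϱ)`: the open ellipse in the complex plane with foci `±1`
whose semi-axes `(ϱ + ϱ⁻¹)/2` and `(ϱ - ϱ⁻¹)/2` sum up to `ϱ`. -/
def bernsteinEllipse (ϱ : ℝ) : Set ℂ :=
  {z : ℂ | ‖z - 1‖ + ‖z + 1‖ < ϱ + ϱ⁻¹}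

/-- The affine map `τ` of the complex plane carrying `[-1,1]` onto `[lo, hi]`. -/
def affineC (lo hi : ℝ) (z : ℂ) : ℂ :=
  (hi : ℂ) + ((lo : ℂ) - (hi : ℂ)) / 2 * (1 - z)

/-- The generalized Bernstein ellipse `B(X, ϱ)` of the hyperrectangle `X = ∏ [lo i, hi i]`. -/
def genBernstein {D : ℕ} (lo hi ϱ : Fin D → ℝ) : Set (Fin D → ℂ) :=
  Set.univ.pi fun i => affineC (lo i) (hi i) '' bernsteinEllipse (ϱ i)

/-- The affine map carrying `[-1,1]^D` onto the hyperrectangle `∏ [lo i, hi i]`. -/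
def fromRef {D : ℕ} (lo hi y : Fin D → ℝ) : Fin D → ℝ :=
  fun i => hi i + (lo i - hi i) / 2 * (1 - y i)

/-- The inverse of `fromRef` (for `lo i < hi i`). -/
def toRef {D : ℕ} (lo hi x : Fin D → ℝ) : Fin D → ℝ :=
  fun i => 1 - 2 * (hi i - x i) / (hi i - lo i)

/-- The index set `J` of all multi-indices `j` with `0 ≤ j i ≤ N i`. -/
def multiIndex {D : ℕ} (N : Fin D → ℕ) : Finset (Fin D → ℕ) :=
  Fintype.piFinset fun i => Finset.range (N i + 1)

/-- The univariate Chebyshev nodes `cos (π k / N)`, `k = 0, …, N`. -/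
def node (N k : ℕ) : ℝ := Real.cos (Real.pi * ((k : ℝ) / (N : ℝ)))

/-- The weight of the `k`-th summand in `∑''`: the first and the last summand are halved. -/
def halfWeight (N k : ℕ) : ℝ := if k = 0 ∨ k = N then 1 / 2 else 1

/-- The coefficient `c_j` of the tensorized Chebyshev interpolation on `[-1,1]^D`. -/
def coeff {D : ℕ} (N : Fin D → ℕ) (g : (Fin D → ℝ) → ℝ) (j : Fin D → ℕ) : ℝ :=
  (∏ i, (if 0 < j i ∧ j i < N i then (2 : ℝ) else 1) / (N i : ℝ)) *
    ∑ k ∈ multiIndex N, (∏ i, halfWeight (N i) (k i)) * g (fun i => node (N i) (k i)) *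
      ∏ i, Real.cos ((j i : ℝ) * Real.pi * ((k i : ℝ) / (N i : ℝ)))

/-- The tensorized Chebyshev interpolation on the reference cube `[-1,1]^D`. -/
def interpRef {D : ℕ} (N : Fin D → ℕ) (g : (Fin D → ℝ) → ℝ) (y : Fin D → ℝ) : ℝ :=
  ∑ j ∈ multiIndex N, coeff N g j * ∏ i, (Polynomial.Chebyshev.T ℝ (j i : ℤ)).eval (y i)

/-- The tensorized Chebyshev interpolation on the hyperrectangle `∏ [lo i, hi i]`, by transport
along the affine map from `[-1,1]^D`. -/
def interp {D : ℕ} (lo hi : Fin D → ℝ) (N : Fin D → ℕ) (f : (Fin D → ℝ) → ℝ)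
    (x : Fin D → ℝ) : ℝ :=
  interpRef N (fun y => f (fromRef lo hi y)) (toRef lo hi x)

/-- The bound that interpolates the coordinates in the order given by `σ`. In the second sum the
`0`-based position `k` stands for the position `k + 1` in `{2, …, D}`. -/
def boundPerm {D : ℕ} (V : ℝ) (ϱ : Fin D → ℝ) (N : Fin D → ℕ) (σ : Equiv.Perm (Fin D)) : ℝ :=
  (∑ i, 4 * V * (ϱ (σ i) ^ (-(N (σ i) : ℤ)) / (ϱ (σ i) - 1))) +
    ∑ k ∈ Finset.univ.filter (fun k : Fin D => 1 ≤ (k : ℕ)),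
      4 * V * (ϱ (σ k) ^ (-(N (σ k) : ℤ)) / (ϱ (σ k) - 1)) * 2 ^ (k : ℕ) *
        (((k : ℝ) + 2 ^ (k : ℕ) - 1) / ∏ j ∈ Finset.univ.filter (fun j => j < k),
          (1 - 1 / ϱ (σ j)))

/-- The bound `a(ϱ, N, D)`: the minimum of `boundPerm` over all permutations. -/
def boundA {D : ℕ} (V : ℝ) (ϱ : Fin D → ℝ) (N : Fin D → ℕ) : ℝ :=
  (Finset.univ : Finset (Equiv.Perm (Fin D))).inf' Finset.univ_nonempty (boundPerm V ϱ N)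

/-- The bound `b(ϱ, N, D)`. -/
def boundB {D : ℕ} (V : ℝ) (ϱ : Fin D → ℝ) (N : Fin D → ℕ) : ℝ :=
  (2 : ℝ) ^ ((D : ℝ) / 2 + 1) * V *
    Real.sqrt (∑ i, ϱ i ^ (-(2 * (N i : ℤ))) * ∏ j, 1 / (1 - ϱ j ^ (-2 : ℤ)))

end ChebInterp

end

/-!
The tensorized interpolation is the composition of univariate interpolations `T i`, one in each
variable. With `E i` the evaluation in the `i`-th variable,
`E i E' - T i T' = (E i - T i) E' + T i (E' - T')`, so univariate error constants `e i` and
interpolation constants `L i` propagate along any ordering of the variables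
(`norm_evalList_sub_interpList_le`). Both bounds follow from this, with different constants. It is
essential that `L i` is measured against the supremum over the ellipse and not over `[-1, 1]`.

A bounded holomorphic `g` on the Bernstein ellipse has a Chebyshev series `∑ a j T j`, and
Parseval's identity for `g ∘ joukowski` on circles of radius tending to `ϱ` gives
`|a 0|² + ∑ |a j|² ϱ ^ (2 j) / 4 ≤ W²` (`exists_chebyshev_expansion`). Interpolation replaces
`T j` by `T m`, where `m ≤ N` is the index onto which `j` is folded (`sum_cardinal_mul_cos`).

* For `boundA`, the termwise estimate `|a j| ≤ 2 W ϱ ^ (-j)` gives `e = 4 ϱ ^ (-N) / (ϱ - 1)` and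
  `L = 2 / (1 - 1 / ϱ)`, and the propagated sum is at most `boundPerm` for every permutation.

* For `boundB`, put `q = ϱ⁻²`. By Cauchy–Schwarz against the Hardy-type norm,
  `e² = K q ^ N` and `L` can be chosen such that `K ≤ 8 / (1 - q)` and
  `K (1 - q) / 8 + L² ≤ 2 / (1 - q)` (`exists_balanced_bounds`). If the variables are ordered by
  increasing `q`, then a further Cauchy–Schwarz inequality in each step shows by induction that the
  square of the propagated constant is at most `4 ∏ 2 / (1 - q i) * ∑ q i ^ N i` (`errorRec_sq_le`).

The balanced constants come from three sources. The dual Hardy norm of the error functional is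
estimated over blocks of folded indices, on which the error of interpolating `cos (j θ)` factors as
`-2 sin (N p θ) sin (u θ)` (`aliasing_energy_le`). The interpolation functional is compared with
`0.8 g (cos θ)` if `q` is small (`shifted_energy_le`). If `q` is close to `1`, the Lebesgue constant of
the nodes is used, whose square is at most `0.9 N` for `N ≥ 4` (`lebesgueBound_sq_le`).
-/

noncomputable section

namespace ChebInterp

/-! ### Chebyshev series on a Bernstein ellipse -/

section ChebyshevSeries

open Complex MeasureTheory

/-- The Joukowski map `w ↦ (w + w⁻¹) / 2`, which carries circles to confocal ellipses. -/
def joukowski (w : ℂ) : ℂ := (w + w⁻¹) / 2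

lemma joukowski_inv (w : ℂ) : joukowski w⁻¹ = joukowski w := by
  simp [joukowski, add_comm]

lemma joukowski_exp (θ : ℝ) : joukowski (exp (θ * I)) = (Real.cos θ : ℂ) := by
  rw [joukowski, ← exp_neg, ofReal_cos, Complex.cos]
  ring_nf

lemma norm_joukowski_sub_add {w : ℂ} (hw : w ≠ 0) :
    ‖joukowski w - 1‖ + ‖joukowski w + 1‖ = ‖w‖ + ‖w‖⁻¹ := by
  have h1 : joukowski w - 1 = (w - 1) ^ 2 / (2 * w) := by
    rw [joukowski]; field_simp; ring
  have h2 : joukowski w + 1 = (w + 1) ^ 2 / (2 * w) := by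
    rw [joukowski]; field_simp; ring
  have hw' : ‖w‖ ≠ 0 := norm_ne_zero_iff.mpr hw
  rw [h1, h2, norm_div, norm_div, norm_pow, norm_pow, norm_mul, ← normSq_eq_norm_sq,
    ← normSq_eq_norm_sq, normSq_sub, normSq_add, normSq_eq_norm_sq]
  simp
  field_simp
  ring

lemma add_inv_lt_add_inv {r ϱ : ℝ} (hr : 1 ≤ r) (h : r < ϱ) : r + r⁻¹ < ϱ + ϱ⁻¹ := by
  have hr0 : 0 < r := by linarith
  have hϱ0 : 0 < ϱ := by linarith
  have : ϱ + ϱ⁻¹ - (r + r⁻¹) = (ϱ - r) * (r * ϱ - 1) / (r * ϱ) := by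
    field_simp; ring
  have h2 : 0 < (ϱ - r) * (r * ϱ - 1) / (r * ϱ) := by
    apply div_pos (mul_pos (by linarith) (by nlinarith)) (by positivity)
  linarith

lemma joukowski_mem {ϱ : ℝ} {w : ℂ} (h1 : 1 ≤ ‖w‖) (h2 : ‖w‖ < ϱ) :
    joukowski w ∈ bernsteinEllipse ϱ := by
  have hw : w ≠ 0 := by
    rintro rfl; norm_num at h1
  rw [bernsteinEllipse, Set.mem_ofPred_eq, norm_joukowski_sub_add hw]
  exact add_inv_lt_add_inv h1 h2

lemma isOpen_bernsteinEllipse (ϱ : ℝ) : IsOpen (bernsteinEllipse ϱ) :=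
  isOpen_lt (by fun_prop) continuous_const

lemma ofReal_mem_bernsteinEllipse {ϱ : ℝ} (hϱ : 1 < ϱ) {y : ℝ} (hy : y ∈ Set.Icc (-1 : ℝ) 1) :
    (y : ℂ) ∈ bernsteinEllipse ϱ := by
  have h1 : ‖(y : ℂ) - 1‖ = 1 - y := by
    rw [← ofReal_one, ← ofReal_sub, norm_real, Real.norm_eq_abs, abs_of_nonpos (by linarith [hy.2])]
    ring
  have h2 : ‖(y : ℂ) + 1‖ = 1 + y := by
    rw [← ofReal_one, ← ofReal_add, norm_real, Real.norm_eq_abs, abs_of_nonneg (by linarith [hy.1])]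
    ring
  have := add_inv_lt_add_inv le_rfl hϱ
  rw [bernsteinEllipse, Set.mem_ofPred_eq, h1, h2]
  norm_num at this
  linarith

section Expansion

variable {ϱ : ℝ} {g : ℂ → ℂ} {W : ℝ}

lemma differentiableAt_comp_joukowski (hg : DifferentiableOn ℂ g (bernsteinEllipse ϱ)) {w : ℂ}
    (h1 : 1 ≤ ‖w‖) (h2 : ‖w‖ < ϱ) : DifferentiableAt ℂ (fun w => g (joukowski w)) w := by
  have hw : w ≠ 0 := by
    rintro rfl; norm_num at h1
  have h3 : DifferentiableAt ℂ g (joukowski w) :=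
    hg.differentiableAt ((isOpen_bernsteinEllipse ϱ).mem_nhds (joukowski_mem h1 h2))
  have h4 : DifferentiableAt ℂ joukowski w :=
    (differentiableAt_id.add (differentiableAt_inv hw)).div_const 2
  exact h3.comp w h4

lemma norm_mul_fourier {r : ℝ} (hr : 0 ≤ r) (x : UnitAddCircle) :
    ‖(r : ℂ) * fourier 1 x‖ = r := by
  rw [norm_mul, fourier_apply, Circle.norm_coe, norm_real, Real.norm_eq_abs, abs_of_nonneg hr,
    mul_one]

/-- The restriction of `g ∘ joukowski` to the circle of radius `r`, as a function on `ℝ / ℤ`. -/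
def onCircle (hg : DifferentiableOn ℂ g (bernsteinEllipse ϱ)) (r : ℝ) (hr : 1 ≤ r ∧ r < ϱ) :
    C(UnitAddCircle, ℂ) where
  toFun x := g (joukowski (r * fourier 1 x))
  continuous_toFun := by
    rw [continuous_iff_continuousAt]
    intro x
    have hn := norm_mul_fourier (by linarith [hr.1] : 0 ≤ r) x
    have h1 := (differentiableAt_comp_joukowski hg (hn.symm ▸ hr.1) (hn.symm ▸ hr.2)).continuousAt
    exact ContinuousAt.comp (f := fun x : UnitAddCircle => (r : ℂ) * fourier 1 x) h1
      (by fun_prop)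

lemma fourierCoeff_onCircle (hg : DifferentiableOn ℂ g (bernsteinEllipse ϱ)) (r : ℝ)
    (hr : 1 ≤ r ∧ r < ϱ) (n : ℤ) :
    fourierCoeff (onCircle hg r hr) n =
      (2 * Real.pi * I)⁻¹ * r ^ n * ∮ z in C(0, r), z ^ (-n - 1) * g (joukowski z) := by
  have hr0 : (r : ℂ) ≠ 0 := by
    have : r ≠ 0 := by linarith [hr.1]
    exact_mod_cast this
  have hpi : (Real.pi : ℂ) ≠ 0 := by exact_mod_cast Real.pi_ne_zero
  rw [fourierCoeff_eq_intervalIntegral _ n 0, circleIntegral]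
  have key : ∀ x : ℝ, fourier (-n) (x : UnitAddCircle) • (onCircle hg r hr) (x : UnitAddCircle) =
      (I)⁻¹ * r ^ n * (fun θ : ℝ => deriv (circleMap 0 r) θ •
        (circleMap 0 r θ ^ (-n - 1) * g (joukowski (circleMap 0 r θ)))) (2 * Real.pi * x) := by
    intro x
    have hx : (r : ℂ) * fourier 1 (x : UnitAddCircle) = circleMap 0 r (2 * Real.pi * x) := by
      rw [fourier_coe_apply, circleMap]
      push_cast
      ring_nf
    have hc : circleMap 0 r (2 * Real.pi * x) ≠ 0 := by
      rw [← hx]; simp [hr0]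
    have hf : fourier (-n) (x : UnitAddCircle) =
        r ^ n * circleMap 0 r (2 * Real.pi * x) ^ (-n) := by
      rw [circleMap, zero_add, mul_zpow, ← exp_int_mul, fourier_coe_apply, ← mul_assoc, ← zpow_add₀ hr0]
      simp
      ring_nf
    simp only [deriv_circleMap, smul_eq_mul, onCircle, ContinuousMap.coe_mk, hx, hf]
    rw [zpow_sub_one₀ hc]
    field_simp
  simp_rw [key]
  rw [intervalIntegral.integral_const_mul,
    intervalIntegral.integral_comp_mul_left (fun θ : ℝ => deriv (circleMap 0 r) θ •
        (circleMap 0 r θ ^ (-n - 1) * g (joukowski (circleMap 0 r θ)))) (by positivity)]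
  simp only [mul_zero, zero_add, mul_one, div_one, one_smul]
  rw [real_smul]
  push_cast
  field_simp

/-- Cauchy's theorem on the annulus: passing from the unit circle to the circle of radius `r`
multiplies the `n`-th Fourier coefficient by `r ^ n`. -/
lemma fourierCoeff_onCircle_eq (hg : DifferentiableOn ℂ g (bernsteinEllipse ϱ)) (r : ℝ)
    (hr : 1 ≤ r ∧ r < ϱ) (n : ℤ) :
    fourierCoeff (onCircle hg r hr) n =
      r ^ n * fourierCoeff (onCircle hg 1 ⟨le_rfl, hr.1.trans_lt hr.2⟩) n := by
  rw [fourierCoeff_onCircle, fourierCoeff_onCircle]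
  have hd : ∀ z : ℂ, 1 ≤ ‖z‖ → ‖z‖ ≤ r →
      DifferentiableAt ℂ (fun z => z ^ (-n - 1) * g (joukowski z)) z := by
    intro z h1 h2
    have hz : z ≠ 0 := by
      rintro rfl; norm_num at h1
    exact (differentiableAt_zpow.mpr (Or.inl hz)).mul
      (differentiableAt_comp_joukowski hg h1 (h2.trans_lt hr.2))
  have := circleIntegral_eq_of_differentiable_on_annulus_off_countable (c := 0) one_pos hr.1
    (f := fun z => z ^ (-n - 1) * g (joukowski z)) Set.countable_empty
    (fun z hz => by
      simp only [Set.mem_sdiff, Metric.mem_closedBall, dist_zero_right, Metric.mem_ball, not_lt] at hz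
      exact (hd z hz.2 hz.1).continuousAt.continuousWithinAt)
    (fun z hz => by
      simp only [Set.mem_sdiff, Metric.mem_closedBall, dist_zero_right, Metric.mem_ball, not_le] at hz
      exact hd z hz.1.2.le hz.1.1.le)
  rw [this]
  simp
  ring

lemma fourierCoeff_onCircle_one_neg (hg : DifferentiableOn ℂ g (bernsteinEllipse ϱ))
    (h : (1 : ℝ) ≤ 1 ∧ 1 < ϱ) (n : ℤ) :
    fourierCoeff (onCircle hg 1 h) (-n) = fourierCoeff (onCircle hg 1 h) n := by
  rw [fourierCoeff, fourierCoeff, ← integral_neg_eq_self]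
  refine integral_congr_ae (Filter.Eventually.of_forall fun x => ?_)
  have hx : fourier (1 : ℤ) (-x : UnitAddCircle) = (fourier 1 x)⁻¹ := by
    simp only [fourier_apply, one_zsmul]
    rw [AddCircle.toCircle_neg, Circle.coe_inv]
  have hx2 : fourier n (-x : UnitAddCircle) = fourier (-n) x := by
    simp [fourier_apply]
  simp only [onCircle, ContinuousMap.coe_mk, ofReal_one, one_mul, hx, joukowski_inv, neg_neg, hx2]

lemma bessel_onCircle (hg : DifferentiableOn ℂ g (bernsteinEllipse ϱ))
    (hW : ∀ z ∈ bernsteinEllipse ϱ, ‖g z‖ ≤ W) (r : ℝ) (hr : 1 ≤ r ∧ r < ϱ) (s : Finset ℤ) :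
    ∑ n ∈ s, ‖fourierCoeff (onCircle hg r hr) n‖ ^ 2 ≤ W ^ 2 := by
  have h1 := hasSum_sq_fourierCoeff
    (ContinuousMap.toLp (E := ℂ) 2 AddCircle.haarAddCircle ℂ (onCircle hg r hr))
  simp only [fourierCoeff_toLp] at h1
  refine (sum_le_hasSum s (fun n _ => by positivity) h1).trans ?_
  have h2 : ∀ᵐ t ∂(AddCircle.haarAddCircle (T := 1)),
      ‖(ContinuousMap.toLp (E := ℂ) 2 AddCircle.haarAddCircle ℂ (onCircle hg r hr)) t‖ ^ 2 ≤
        W ^ 2 := by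
    filter_upwards [ContinuousMap.coeFn_toLp (p := 2) (𝕜 := ℂ) AddCircle.haarAddCircle
      (onCircle hg r hr)] with t ht
    rw [ht]
    have hn := norm_mul_fourier (by linarith [hr.1] : 0 ≤ r) t
    exact pow_le_pow_left₀ (norm_nonneg _)
      (hW _ (joukowski_mem (hn.symm ▸ hr.1) (hn.symm ▸ hr.2))) 2
  have h3 : ∫ t, ‖(ContinuousMap.toLp (E := ℂ) 2 AddCircle.haarAddCircle ℂ
      (onCircle hg r hr)) t‖ ^ 2 ∂(AddCircle.haarAddCircle (T := 1)) ≤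
      ∫ _, W ^ 2 ∂(AddCircle.haarAddCircle (T := 1)) :=
    integral_mono_of_nonneg (Filter.Eventually.of_forall fun t => by positivity)
      (integrable_const _) h2
  simpa using h3

end Expansion

/-- The reciprocal weights of the Hardy-type norm `|a 0| ^ 2 + ∑ |a j| ^ 2 / (4 q ^ j)` on Chebyshev
series, for `q = ϱ⁻²`. -/
def hardyWeight (q : ℝ) (j : ℕ) : ℝ := if j = 0 then 1 else 4 * q ^ j

lemma hardyWeight_pos {q : ℝ} (hq : 0 < q) (j : ℕ) : 0 < hardyWeight q j := by
  unfold hardyWeight; split_ifs <;> positivity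

/-- A holomorphic function on the Bernstein ellipse that is bounded by `W` is, on `[-1, 1]`, the sum
of a Chebyshev series whose coefficients satisfy Parseval's inequality on the ellipse. -/
theorem exists_chebyshev_expansion {ϱ : ℝ} (hϱ : 1 < ϱ) {g : ℂ → ℂ} {W : ℝ}
    (hg : DifferentiableOn ℂ g (bernsteinEllipse ϱ))
    (hW : ∀ z ∈ bernsteinEllipse ϱ, ‖g z‖ ≤ W) :
    ∃ a : ℕ → ℂ,
      (∀ θ : ℝ, HasSum (fun j : ℕ => a j * (Real.cos (j * θ) : ℂ)) (g (Real.cos θ : ℂ))) ∧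
      ∀ n, ∑ j ∈ Finset.range n, ‖a j‖ ^ 2 / hardyWeight ((ϱ ^ 2)⁻¹) j ≤ W ^ 2 := by
  have h1 : (1 : ℝ) ≤ 1 ∧ 1 < ϱ := ⟨le_rfl, hϱ⟩
  set b : ℤ → ℂ := fourierCoeff (onCircle hg 1 h1) with hb
  have hbneg : ∀ n, b (-n) = b n := fourierCoeff_onCircle_one_neg hg h1
  have hW0 : 0 ≤ W := (norm_nonneg _).trans (hW _ (ofReal_mem_bernsteinEllipse hϱ (y := 0) (by simp)))
  have hpars : ∀ s : Finset ℕ, ∑ n ∈ s, ‖b n‖ ^ 2 * (ϱ ^ 2) ^ n ≤ W ^ 2 := by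
    intro s
    have hlim : Filter.Tendsto (fun r : ℝ => ∑ n ∈ s, ‖b n‖ ^ 2 * (r ^ 2) ^ n) (nhdsWithin ϱ (Set.Iio ϱ))
        (nhds (∑ n ∈ s, ‖b n‖ ^ 2 * (ϱ ^ 2) ^ n)) := by
      apply Filter.Tendsto.mono_left _ nhdsWithin_le_nhds
      exact Continuous.tendsto (by fun_prop) ϱ
    refine le_of_tendsto hlim ?_
    filter_upwards [Ioo_mem_nhdsLT hϱ] with r hr
    have := bessel_onCircle hg hW r ⟨hr.1.le, hr.2⟩ (s.map ⟨Nat.cast, Nat.cast_injective⟩)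
    rw [Finset.sum_map] at this
    refine le_trans (le_of_eq (Finset.sum_congr rfl fun n _ => ?_)) this
    simp only [Function.Embedding.coeFn_mk]
    rw [fourierCoeff_onCircle_eq, norm_mul, mul_pow]
    simp only [zpow_natCast, norm_pow, norm_real, Real.norm_eq_abs]
    rw [← pow_mul, ← pow_mul, pow_mul, pow_mul, abs_of_pos (by linarith [hr.1])]
    rw [mul_comm, ← pow_mul, ← pow_mul, mul_comm 2 n]
  have hbound : ∀ n : ℕ, ‖b n‖ ≤ W * (ϱ⁻¹) ^ n := by
    intro n
    have := hpars {n}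
    rw [Finset.sum_singleton] at this
    have h2 : (‖b n‖ * ϱ ^ n) ^ 2 ≤ W ^ 2 := by
      calc _ = ‖b n‖ ^ 2 * (ϱ ^ 2) ^ n := by ring
        _ ≤ _ := this
    have h3 := abs_le_of_sq_le_sq' h2 hW0
    have h4 : 0 < ϱ ^ n := by positivity
    rw [inv_pow, ← div_eq_mul_inv, le_div_iff₀ h4]
    exact h3.2
  have hsumN : Summable fun n : ℕ => b n :=
    Summable.of_norm_bounded ((summable_geometric_of_lt_one (by positivity)
      (inv_lt_one_of_one_lt₀ hϱ)).mul_left W) hbound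
  have hsum : Summable b := by
    apply Summable.of_nat_of_neg hsumN
    simpa only [hbneg] using hsumN
  have hpt : ∀ x : ℝ, HasSum (fun n : ℤ => b n * exp (2 * Real.pi * I * n * x))
      (g (Real.cos (2 * Real.pi * x) : ℂ)) := by
    intro x
    have := has_pointwise_sum_fourier_series_of_summable (f := onCircle hg 1 h1) hsum
      (x : UnitAddCircle)
    simp only [fourier_coe_apply, smul_eq_mul, ofReal_one, div_one] at this
    convert this using 1
    simp only [onCircle, ContinuousMap.coe_mk, fourier_coe_apply, ofReal_one, one_mul, div_one]
    rw [← joukowski_exp]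
    push_cast
    ring_nf
  refine ⟨fun j => if j = 0 then b 0 else 2 * b j, fun θ => ?_, fun n => ?_⟩
  · have h2 := (hpt (θ / (2 * Real.pi))).nat_add_neg
    have hθ : 2 * Real.pi * (θ / (2 * Real.pi)) = θ := by field_simp
    rw [hθ] at h2
    have h3 := h2.sub (hasSum_ite_eq (0 : ℕ) (b 0))
    simp only [Int.cast_zero, mul_zero, zero_mul, exp_zero, mul_one, add_sub_cancel_right] at h3
    have hθ' : (2 : ℂ) * Real.pi * ((θ / (2 * Real.pi) : ℝ) : ℂ) = θ := by
      exact_mod_cast congrArg ofReal hθ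
    refine h3.congr_fun fun j => ?_
    have e1 : (2 : ℂ) * Real.pi * I * ((j : ℤ) : ℂ) * ((θ / (2 * Real.pi) : ℝ) : ℂ) =
        (j * θ) * I := by
      rw [← hθ']; push_cast; ring
    have e2 : (2 : ℂ) * Real.pi * I * ((-(j : ℤ) : ℤ) : ℂ) * ((θ / (2 * Real.pi) : ℝ) : ℂ) =
        -(j * θ) * I := by
      rw [← hθ']; push_cast; ring
    rw [e1, e2, hbneg]
    rcases eq_or_ne j 0 with rfl | hj
    · simp
    · simp only [hj, if_false, sub_zero]
      rw [ofReal_cos, Complex.cos]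
      push_cast
      ring
  · have h2 := hpars (Finset.range n)
    refine le_trans (Finset.sum_le_sum fun j _ => ?_) h2
    rcases eq_or_ne j 0 with rfl | hj
    · simp [hardyWeight]
    · simp only [hj, if_false, hardyWeight, norm_mul, RCLike.norm_ofNat, mul_pow]
      rw [inv_pow]
      field_simp
      norm_num
      linarith

end ChebyshevSeries

open Real Finset

/-! ### Discrete cosine sums and aliasing -/

/-- The trapezoidal cosine sum `∑'' cos (j t)` over `j = 0, …, N`. -/
def trapCos (N : ℕ) (t : ℝ) : ℝ := ∑ j ∈ range (N + 1), halfWeight N j * cos (j * t)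

lemma halfWeight_nonneg (N k : ℕ) : 0 ≤ halfWeight N k := by
  unfold halfWeight; split_ifs <;> norm_num

/-- The sum `∑''` as a trapezoidal rule. -/
lemma sum_halfWeight_mul {N : ℕ} (hN : 1 ≤ N) (f : ℕ → ℝ) :
    ∑ j ∈ range (N + 1), halfWeight N j * f j = ∑ j ∈ range N, (f j + f (j + 1)) / 2 := by
  obtain ⟨M, rfl⟩ : ∃ M, N = M + 1 := ⟨N - 1, by omega⟩
  rw [Finset.sum_range_succ, Finset.sum_range_succ']
  have h1 : ∑ j ∈ range M, halfWeight (M + 1) (j + 1) * f (j + 1) = ∑ j ∈ range M, f (j + 1) := by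
    refine Finset.sum_congr rfl fun j hj => ?_
    rw [mem_range] at hj
    rw [halfWeight, if_neg (by omega), one_mul]
  have h2 : halfWeight (M + 1) 0 = 1 / 2 := by simp [halfWeight]
  have h3 : halfWeight (M + 1) (M + 1) = 1 / 2 := by simp [halfWeight]
  rw [h1, h2, h3]
  simp_rw [add_div]
  rw [Finset.sum_add_distrib, Finset.sum_range_succ', Finset.sum_range_succ (fun j => f (j + 1) / 2)]
  simp_rw [div_eq_mul_inv, ← Finset.sum_mul]
  ring

/-- The closed form `trapCos N t = sin (N t) cot (t / 2) / 2`, with the denominator cleared. -/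
lemma two_mul_sin_mul_trapCos {N : ℕ} (hN : 1 ≤ N) (t : ℝ) :
    2 * sin (t / 2) * trapCos N t = sin (N * t) * cos (t / 2) := by
  rw [trapCos, sum_halfWeight_mul hN (fun j => cos (j * t)), Finset.mul_sum]
  have key : ∀ j : ℕ, 2 * sin (t / 2) * ((cos (j * t) + cos ((j + 1 : ℕ) * t)) / 2) =
      cos (t / 2) * sin ((j + 1 : ℕ) * t) - cos (t / 2) * sin (j * t) := by
    intro j
    obtain ⟨a, ha⟩ : ∃ a, a = j * t + t / 2 := ⟨_, rfl⟩
    have e1 : (j : ℝ) * t = a - t / 2 := by rw [ha]; ring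
    have e2 : ((j + 1 : ℕ) : ℝ) * t = a + t / 2 := by rw [ha]; push_cast; ring
    rw [e2, e1, cos_add, cos_sub, sin_add, sin_sub]
    ring
  simp_rw [key]
  rw [Finset.sum_range_sub (fun j : ℕ => cos (t / 2) * sin (j * t))]
  simp
  ring

lemma trapCos_neg (N : ℕ) (t : ℝ) : trapCos N (-t) = trapCos N t := by
  simp [trapCos]

/-- At integer multiples `n π / N` the trapezoidal cosine sum vanishes unless `2 N ∣ n`. -/
lemma trapCos_int_mul {N : ℕ} (hN : 1 ≤ N) (n : ℤ) (h1 : n ≠ 0) (h2 : |n| < 2 * N) :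
    trapCos N (n * (π / N)) = 0 := by
  have hN0 : (N : ℝ) ≠ 0 := by positivity
  have h := two_mul_sin_mul_trapCos hN (n * (π / N))
  have h3 : (N : ℝ) * (n * (π / N)) = n * π := by field_simp
  rw [h3, sin_int_mul_pi, zero_mul] at h
  have h4 : sin (n * (π / N) / 2) ≠ 0 := by
    intro h5
    rw [sin_eq_zero_iff] at h5
    obtain ⟨m, hm⟩ := h5
    have h6 : (m : ℝ) * (2 * N) = n := by
      field_simp at hm
      linarith
    have h7 : m * (2 * N) = n := by exact_mod_cast h6
    have h8 : m ≠ 0 := by rintro rfl; simp at h7; exact h1 h7.symm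
    rw [← h7, abs_mul, abs_of_nonneg (by positivity : (0 : ℤ) ≤ 2 * N)] at h2
    have h9 : 1 ≤ |m| := Int.one_le_abs h8
    nlinarith
  simpa [h4] using h

lemma trapCos_zero {N : ℕ} (hN : 1 ≤ N) : trapCos N 0 = N := by
  rw [trapCos, sum_halfWeight_mul hN (fun j => cos (j * 0))]
  simp

lemma trapCos_two_pi {N : ℕ} (hN : 1 ≤ N) : trapCos N (2 * π) = N := by
  rw [← trapCos_zero hN]
  unfold trapCos
  refine Finset.sum_congr rfl fun j _ => ?_
  rw [mul_zero, cos_zero, cos_nat_mul_two_pi]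

/-- Discrete orthogonality of the cosines. -/
lemma sum_halfWeight_cos_mul_cos {N : ℕ} (hN : 1 ≤ N) {i m : ℕ} (hi : i ≤ N) (hm : m ≤ N) :
    halfWeight N i * ∑ k ∈ range (N + 1), halfWeight N k * (cos (i * (k * (π / N))) * cos (m * (k * (π / N)))) =
      if i = m then (N : ℝ) / 2 else 0 := by
  have hN0 : (N : ℝ) ≠ 0 := by positivity
  have h1 : ∑ k ∈ range (N + 1), halfWeight N k * (cos (i * (k * (π / N))) * cos (m * (k * (π / N)))) =
      (trapCos N (((i : ℤ) - m : ℤ) * (π / N)) + trapCos N (((i : ℤ) + m : ℤ) * (π / N))) / 2 := by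
    rw [trapCos, trapCos, ← Finset.sum_add_distrib, Finset.sum_div]
    refine Finset.sum_congr rfl fun k _ => ?_
    have e1 : (k : ℝ) * ((((i : ℤ) - m : ℤ) : ℝ) * (π / N)) = i * (k * (π / N)) - m * (k * (π / N)) := by
      push_cast; ring
    have e2 : (k : ℝ) * ((((i : ℤ) + m : ℤ) : ℝ) * (π / N)) = i * (k * (π / N)) + m * (k * (π / N)) := by
      push_cast; ring
    rw [e1, e2, cos_add, cos_sub]
    ring
  rw [h1]
  split_ifs with h
  · subst h
    rw [sub_self]
    by_cases h0 : i = 0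
    · subst h0
      simp [trapCos_zero hN, halfWeight]
      ring
    · by_cases h2 : i = N
      · subst h2
        have : (((i : ℤ) + i : ℤ) : ℝ) * (π / i) = 2 * π := by push_cast; field_simp; ring
        rw [this, trapCos_two_pi hN]
        simp [trapCos_zero hN, halfWeight]
        ring
      · rw [trapCos_int_mul hN ((i : ℤ) + i) (by omega) (by rw [abs_of_nonneg (by positivity)]; omega)]
        simp [trapCos_zero hN, halfWeight, h0, h2]
  · rw [trapCos_int_mul hN ((i : ℤ) - m) (by omega) (by rw [abs_lt]; omega),
      trapCos_int_mul hN ((i : ℤ) + m) (by omega) (by rw [abs_of_nonneg (by positivity)]; omega)]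
    simp

/-- The weight of the `k`-th node in univariate Chebyshev interpolation at the point `y`. -/
def cardinal (N k : ℕ) (y : ℝ) : ℝ :=
  halfWeight N k * ∑ j ∈ range (N + 1), (if 0 < j ∧ j < N then (2 : ℝ) else 1) / (N : ℝ) *
    (cos ((j : ℝ) * π * ((k : ℝ) / (N : ℝ))) * (Polynomial.Chebyshev.T ℝ (j : ℤ)).eval y)

lemma cardinal_cos (N k : ℕ) (θ : ℝ) :
    cardinal N k (cos θ) = halfWeight N k * ∑ j ∈ range (N + 1), 2 / N * halfWeight N j *
      (cos (j * (k * (π / N))) * cos (j * θ)) := by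
  rw [cardinal]
  congr 1
  refine Finset.sum_congr rfl fun j hj => ?_
  rw [mem_range] at hj
  rw [Polynomial.Chebyshev.T_real_cos]
  have e : (j : ℝ) * π * ((k : ℝ) / N) = j * (k * (π / N)) := by ring
  rw [e]
  have : (if 0 < j ∧ j < N then (2 : ℝ) else 1) / (N : ℝ) = 2 / N * halfWeight N j := by
    unfold halfWeight
    by_cases h : 0 < j ∧ j < N
    · rw [if_pos h, if_neg (by omega), mul_one]
    · rw [if_neg h, if_pos (by omega)]; ring
  rw [this]
  simp

lemma cardinal_cos_eq_trapCos (N k : ℕ) (θ : ℝ) :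
    cardinal N k (cos θ) = halfWeight N k / N *
      (trapCos N (θ - k * (π / N)) + trapCos N (θ + k * (π / N))) := by
  rw [cardinal_cos, trapCos, trapCos, ← Finset.sum_add_distrib, Finset.mul_sum, Finset.mul_sum]
  refine Finset.sum_congr rfl fun j _ => ?_
  rw [mul_sub, mul_add (j : ℝ), cos_sub, cos_add]
  ring

/-- The degree `m ≤ N` such that `T_j` and `T_m` agree on the nodes `cos (π k / N)`. -/
def aliasIndex (N j : ℕ) : ℕ := if j % (2 * N) ≤ N then j % (2 * N) else 2 * N - j % (2 * N)

lemma aliasIndex_le (N j : ℕ) : aliasIndex N j ≤ N := by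
  unfold aliasIndex; split_ifs <;> omega

lemma aliasIndex_of_le {N j : ℕ} (h : j ≤ N) : aliasIndex N j = j := by
  rcases Nat.eq_zero_or_pos N with rfl | hN
  · simp [aliasIndex, show j = 0 by omega]
  · rw [aliasIndex, Nat.mod_eq_of_lt (by omega), if_pos h]

lemma cos_aliasIndex {N j p : ℕ} (hN : 1 ≤ N) (h1 : 2 * N * p ≤ j + N) (h2 : j ≤ 2 * N * p + N)
    (θ : ℝ) : cos (aliasIndex N j * θ) = cos (j * θ - 2 * (N * p * θ)) := by
  rcases le_total (2 * N * p) j with h | h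
  · obtain ⟨s, rfl⟩ := Nat.exists_eq_add_of_le h
    have : aliasIndex N (2 * N * p + s) = s := by
      have : (2 * N * p + s) % (2 * N) = s := by
        rw [Nat.mul_add_mod]; exact Nat.mod_eq_of_lt (by omega)
      rw [aliasIndex, this, if_pos (by omega)]
    rw [this]
    congr 1
    push_cast; ring
  · obtain ⟨s, hs⟩ := Nat.exists_eq_add_of_le h
    rcases Nat.eq_zero_or_pos s with rfl | hs0
    · have : aliasIndex N j = 0 := by
        rw [aliasIndex, show j = 2 * N * p by omega, Nat.mul_mod_right]; simp
      rw [this]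
      have : (j : ℝ) = 2 * N * p := by exact_mod_cast (show j = 2 * N * p by omega)
      rw [this]
      congr 1
      push_cast; ring
    · obtain ⟨p', rfl⟩ : ∃ p', p = p' + 1 := ⟨p - 1, by
        rcases Nat.eq_zero_or_pos p with rfl | hp
        · simp at hs; omega
        · omega⟩
      have hj : j = 2 * N * p' + (2 * N - s) := by
        rw [mul_add, mul_one] at hs h1; omega
      have hmod : j % (2 * N) = 2 * N - s := by
        rw [hj, Nat.mul_add_mod]; exact Nat.mod_eq_of_lt (by omega)
      have : aliasIndex N j = s := by
        rw [aliasIndex, hmod]; split_ifs <;> omega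
      rw [this, ← cos_neg]
      have hj' : (j : ℝ) + s = 2 * N * (p' + 1) := by exact_mod_cast hs.symm
      congr 1
      push_cast
      linear_combination (-θ) * hj'

/-- In the block of length `2 N` around `2 N p`, the error of interpolating `cos (j θ)` is a product of
sines, whose first factor depends on the block only. -/
lemma cos_sub_cos_aliasIndex {N j p : ℕ} (hN : 1 ≤ N) (h1 : 2 * N * p ≤ j + N)
    (h2 : j ≤ 2 * N * p + N) (θ : ℝ) :
    cos (j * θ) - cos (aliasIndex N j * θ) = -2 * sin (N * p * θ) * sin ((j - N * p) * θ) := by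
  rw [cos_aliasIndex hN h1 h2, sub_mul]
  obtain ⟨a, ha⟩ : ∃ a, a = (j : ℝ) * θ - N * p * θ := ⟨_, rfl⟩
  have e1 : (j : ℝ) * θ - 2 * (N * p * θ) = a - N * p * θ := by rw [ha]; ring
  have e2 : cos (j * θ) = cos (a + N * p * θ) := by rw [ha]; ring_nf
  rw [e1, e2, ← ha, cos_add, cos_sub]
  ring

/-- Every `j` lies within distance `N` of a multiple of `2 N`. -/
lemma exists_aliasing_block {N : ℕ} (hN : 1 ≤ N) (j : ℕ) :
    ∃ p, 2 * N * p ≤ j + N ∧ j ≤ 2 * N * p + N := by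
  refine ⟨(j + N) / (2 * N), Nat.mul_div_le _ _, ?_⟩
  have := Nat.div_add_mod (j + N) (2 * N)
  have := Nat.mod_lt (j + N) (show 0 < 2 * N by omega)
  omega

/-- At the nodes, `T_j` and `T_m` agree for `m = aliasIndex N j`. -/
lemma cos_aliasIndex_node {N : ℕ} (hN : 1 ≤ N) (j : ℕ) {θ : ℝ} (hθ : sin (N * θ) = 0) :
    cos (aliasIndex N j * θ) = cos (j * θ) := by
  obtain ⟨p, h1, h2⟩ := exists_aliasing_block hN j
  have h := cos_sub_cos_aliasIndex hN h1 h2 θ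
  have h3 : sin (N * p * θ) = 0 := by
    rw [sin_eq_zero_iff] at hθ ⊢
    obtain ⟨n, hn⟩ := hθ
    exact ⟨n * p, by push_cast; linear_combination (p : ℝ) * hn⟩
  rw [h3] at h
  linarith

/-- Interpolating `T_j` gives `T_m` with `m = aliasIndex N j`. -/
lemma sum_cardinal_mul_cos {N : ℕ} (hN : 1 ≤ N) (j : ℕ) (θ : ℝ) :
    ∑ k ∈ range (N + 1), cardinal N k (cos θ) * cos (j * (k * (π / N))) =
      cos (aliasIndex N j * θ) := by
  have hN0 : (N : ℝ) ≠ 0 := by positivity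
  have h1 : ∀ k : ℕ, cos (j * (k * (π / N))) = cos (aliasIndex N j * (k * (π / N))) := by
    intro k
    refine (cos_aliasIndex_node hN j ?_).symm
    rw [show (N : ℝ) * (k * (π / N)) = k * π by field_simp, sin_nat_mul_pi]
  set m := aliasIndex N j
  have hm : m ≤ N := aliasIndex_le N j
  calc _ = ∑ i ∈ range (N + 1), 2 / N * cos (i * θ) * (halfWeight N i * ∑ k ∈ range (N + 1),
        halfWeight N k * (cos (i * (k * (π / N))) * cos (m * (k * (π / N))))) := by
        simp_rw [h1, cardinal_cos, Finset.mul_sum, Finset.sum_mul]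
        rw [Finset.sum_comm]
        refine Finset.sum_congr rfl fun i _ => Finset.sum_congr rfl fun k _ => ?_
        ring
    _ = ∑ i ∈ range (N + 1), if i = m then cos (m * θ) else 0 := by
        refine Finset.sum_congr rfl fun i hi => ?_
        rw [mem_range] at hi
        rw [sum_halfWeight_cos_mul_cos hN (by omega) hm]
        split_ifs with h
        · rw [h]; field_simp
        · simp
    _ = _ := by
        rw [Finset.sum_ite_eq', if_pos (mem_range.mpr (by omega))]

/-! ### The Lebesgue constant -/

/-- Unfolding `∑''` over the nodes to a sum over a full period, as in the even extension of a cosine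
series. -/
lemma sum_halfWeight_mul_add_reflect {N : ℕ} (hN : 1 ≤ N) (f : ℕ → ℝ) (hf : f (2 * N) = f 0) :
    ∑ k ∈ range (N + 1), halfWeight N k * (f k + f (2 * N - k)) = ∑ i ∈ range (2 * N), f i := by
  have h1 : ∑ i ∈ range (2 * N), f i = ∑ i ∈ range (2 * N), (f i + f (i + 1)) / 2 := by
    have h := Finset.sum_range_succ f (2 * N)
    rw [Finset.sum_range_succ', hf] at h
    rw [← Finset.sum_div, Finset.sum_add_distrib]
    linarith
  rw [h1, sum_halfWeight_mul hN (fun k => f k + f (2 * N - k)), two_mul,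
    Finset.sum_range_add, ← Finset.sum_range_reflect (fun x => (f (N + x) + f (N + x + 1)) / 2),
    ← Finset.sum_add_distrib]
  refine Finset.sum_congr rfl fun i hi => ?_
  rw [mem_range] at hi
  rw [show N + (N - 1 - i) = N + N - (i + 1) by omega, show N + N - (i + 1) + 1 = N + N - i by omega]
  ring

lemma sum_range_int_shift {M : ℕ} (Φ : ℤ → ℝ) (hΦ : ∀ n, Φ (n + M) = Φ n) (κ : ℤ) :
    ∑ i ∈ range M, Φ (κ - i) = ∑ i ∈ range M, Φ i := by
  rcases Nat.eq_zero_or_pos M with rfl | hM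
  · simp
  obtain ⟨m, rfl⟩ : ∃ m, M = m + 1 := ⟨M - 1, by omega⟩
  have hstep : ∀ κ : ℤ, ∑ i ∈ range (m + 1), Φ (κ + 1 - i) = ∑ i ∈ range (m + 1), Φ (κ - i) := by
    intro κ
    rw [Finset.sum_range_succ', Finset.sum_range_succ]
    congr 1
    · refine Finset.sum_congr rfl fun i _ => ?_
      congr 1; push_cast; ring
    · rw [← hΦ (κ - m)]
      congr 1; push_cast; ring
  have hconst : ∀ κ : ℤ, ∑ i ∈ range (m + 1), Φ (κ - i) = ∑ i ∈ range (m + 1), Φ (0 - i) := by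
    intro κ
    induction κ using Int.induction_on with
    | zero => rfl
    | succ n ih => rw [hstep, ih]
    | pred n ih => rw [← hstep, sub_add_cancel, ih]
  rw [hconst κ, ← hconst m, ← Finset.sum_range_reflect]
  refine Finset.sum_congr rfl fun i hi => ?_
  rw [mem_range] at hi
  congr 1
  omega

lemma trapCos_add_two_pi (N : ℕ) (t : ℝ) : trapCos N (t + 2 * π) = trapCos N t := by
  unfold trapCos
  refine Finset.sum_congr rfl fun j _ => ?_
  rw [mul_add, cos_add_nat_mul_two_pi]

/-- The Lebesgue function at `cos θ`, with `N θ = z + κ π`, in terms of `2 N` equispaced values of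
`trapCos`; periodicity removes the dependence on `κ`. -/
lemma sum_abs_cardinal_le {N : ℕ} (hN : 1 ≤ N) (z : ℝ) (κ : ℤ) :
    ∑ k ∈ range (N + 1), |cardinal N k (cos ((z + κ * π) / N))| ≤
      (∑ i ∈ range (2 * N), |trapCos N ((z + i * π) / N)|) / N := by
  have hN0 : (0 : ℝ) < N := by positivity
  set Φ : ℤ → ℝ := fun n => |trapCos N ((z + n * π) / N)| with hΦ
  have hper : ∀ n, Φ (n + (2 * N : ℕ)) = Φ n := by
    intro n
    simp only [hΦ]
    rw [← trapCos_add_two_pi N ((z + n * π) / N)]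
    congr 2
    push_cast
    field_simp
    ring
  have h1 := sum_halfWeight_mul_add_reflect hN (fun k => Φ (κ - k)) (by
    rw [← hper (κ - (2 * N : ℕ))]; simp)
  rw [sum_range_int_shift Φ hper] at h1
  simp only [hΦ, Int.cast_natCast] at h1
  rw [← h1, Finset.sum_div]
  refine Finset.sum_le_sum fun k hk => ?_
  rw [mem_range] at hk
  rw [cardinal_cos_eq_trapCos, abs_mul, abs_div, abs_of_nonneg (halfWeight_nonneg N k),
    abs_of_pos hN0, div_mul_eq_mul_div]
  gcongr
  · exact halfWeight_nonneg N k
  refine (abs_add_le _ _).trans (le_of_eq ?_)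
  congr 2
  · congr 1; push_cast; field_simp; ring
  · rw [← trapCos_neg, ← trapCos_add_two_pi, ← trapCos_neg]
    congr 1
    rw [Nat.cast_sub (by omega)]
    push_cast; field_simp; ring

/-- The bound `cot u ≤ 1 / u - u / 3` on `(0, π / 2]`, with denominators cleared. -/
lemma mul_cos_le_sin_mul {u : ℝ} (h0 : 0 ≤ u) (hu : u ≤ π / 2) :
    u * cos u ≤ (1 - u ^ 2 / 3) * sin u := by
  have key : ∀ x : ℝ, HasDerivAt (fun u => (1 - u ^ 2 / 3) * sin u - u * cos u)
      (x / 3 * (sin x - x * cos x)) x := by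
    intro x
    have h1 : HasDerivAt (fun u : ℝ => 1 - u ^ 2 / 3) (-(2 * x / 3)) x := by
      have := ((hasDerivAt_pow 2 x).div_const 3).const_sub 1
      simpa using this
    have := (h1.mul (hasDerivAt_sin x)).sub ((hasDerivAt_id x).mul (hasDerivAt_cos x))
    exact this.congr_deriv (by simp; ring)
  have key2 : ∀ x : ℝ, HasDerivAt (fun u => sin u - u * cos u) (x * sin x) x := by
    intro x
    have := (hasDerivAt_sin x).sub ((hasDerivAt_id x).mul (hasDerivAt_cos x))
    exact this.congr_deriv (by simp)
  have hmono2 : MonotoneOn (fun u => sin u - u * cos u) (Set.Icc 0 (π / 2)) := by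
    apply monotoneOn_of_deriv_nonneg (convex_Icc _ _)
      (fun x _ => (key2 x).continuousAt.continuousWithinAt)
      (fun x _ => (key2 x).differentiableAt.differentiableWithinAt)
    intro x hx
    rw [interior_Icc] at hx
    rw [(key2 x).deriv]
    exact mul_nonneg hx.1.le (sin_nonneg_of_nonneg_of_le_pi hx.1.le (by linarith [hx.2, pi_pos]))
  have hmono : MonotoneOn (fun u => (1 - u ^ 2 / 3) * sin u - u * cos u) (Set.Icc 0 (π / 2)) := by
    apply monotoneOn_of_deriv_nonneg (convex_Icc _ _)
      (fun x _ => (key x).continuousAt.continuousWithinAt)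
      (fun x _ => (key x).differentiableAt.differentiableWithinAt)
    intro x hx
    rw [interior_Icc] at hx
    rw [(key x).deriv]
    have := hmono2 ⟨le_rfl, by positivity⟩ ⟨hx.1.le, hx.2.le⟩ hx.1.le
    simp only [sin_zero, zero_mul, sub_zero] at this
    exact mul_nonneg (by linarith [hx.1]) this
  have := hmono ⟨le_rfl, by positivity⟩ ⟨h0, hu⟩ h0
  simp only [sin_zero, mul_zero, zero_mul, sub_zero] at this
  linarith

/-- Sharp quadratic bound for the sine on `[0, π]`, with equality at `0`, `π / 2` and `π`. -/
lemma sin_le_parabola {z : ℝ} (h0 : 0 ≤ z) (hz : z ≤ π) :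
    sin z ≤ 1 - 4 / π ^ 2 * (z - π / 2) ^ 2 := by
  have hpi := pi_pos
  set t := |z - π / 2| / 2 with ht
  have ht0 : 0 ≤ t := by positivity
  have ht1 : t ≤ π / 4 := by
    have : |z - π / 2| ≤ π / 2 := by rw [abs_le]; constructor <;> linarith
    rw [ht]; linarith
  have h1 : sin z = 1 - 2 * sin t ^ 2 := by
    have : sin z = cos (2 * t) := by
      rw [ht, mul_div_cancel₀ _ two_ne_zero, cos_abs, cos_sub_pi_div_two]
    rw [this, cos_two_mul, cos_sq']; ring
  -- concavity of the sine on `[0, π / 4]`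
  have h2 : 4 * t / π * (√2 / 2) ≤ sin t := by
    have hc := (strictConcaveOn_sin_Icc.concaveOn).2
      (show (0 : ℝ) ∈ Set.Icc 0 π from ⟨le_rfl, hpi.le⟩)
      (show π / 4 ∈ Set.Icc 0 π from ⟨by positivity, by linarith⟩)
      (show 0 ≤ 1 - 4 * t / π by rw [sub_nonneg, div_le_one hpi]; linarith)
      (show 0 ≤ 4 * t / π by positivity) (by ring)
    simp only [sin_zero, smul_eq_mul, mul_zero, zero_add, sin_pi_div_four] at hc
    rwa [show 4 * t / π * (π / 4) = t by field_simp] at hc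
  have h3 : (4 * t / π * (√2 / 2)) ^ 2 ≤ sin t ^ 2 := pow_le_pow_left₀ (by positivity) h2 2
  have h4 : (4 * t / π * (√2 / 2)) ^ 2 = 8 * t ^ 2 / π ^ 2 := by
    rw [mul_pow, div_pow √2, sq_sqrt zero_le_two]; ring
  have h5 : t ^ 2 = (z - π / 2) ^ 2 / 4 := by rw [ht, div_pow, sq_abs]; norm_num
  rw [h4, h5] at h3
  rw [h1]
  have : 4 / π ^ 2 * (z - π / 2) ^ 2 = 2 * (8 * ((z - π / 2) ^ 2 / 4) / π ^ 2) := by ring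
  linarith

/-- A bound for the Lebesgue constant of Chebyshev interpolation of degree `N ≥ 2`. The
sum arises from `cot u ≤ 1 / u` at the midpoint between two nodes, and `π / 12` is what the sharper
`cot u ≤ 1 / u - u / 3` saves. -/
def lebesgueBound (N : ℕ) : ℝ := ∑ i ∈ range N, 4 / (π * (2 * i + 1)) - π / 12

lemma abs_trapCos_le {N : ℕ} (hN : 1 ≤ N) {z : ℝ} (h0 : 0 < z) (hz : z < π) {i : ℕ} (hi : i < N) :
    |trapCos N ((z + i * π) / N)| ≤ sin z * (N / (z + i * π) - (z + i * π) / (12 * N)) := by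
  have hpi := pi_pos
  have hN0 : (0 : ℝ) < N := by positivity
  set u := (z + i * π) / (2 * N) with hu
  have hi' : (i : ℝ) + 1 ≤ N := by exact_mod_cast hi
  have hu0 : 0 < u := by positivity
  have hu1 : u ≤ π / 2 := by
    rw [hu, div_le_iff₀ (by positivity)]; nlinarith
  have hs : 0 < sin u := sin_pos_of_pos_of_lt_pi hu0 (by linarith)
  have hc : 0 ≤ cos u := cos_nonneg_of_mem_Icc ⟨by linarith, hu1⟩
  have hsz : 0 ≤ sin z := sin_nonneg_of_nonneg_of_le_pi h0.le hz.le
  have h1 := two_mul_sin_mul_trapCos hN ((z + i * π) / N)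
  rw [show (z + i * π) / N / 2 = u by rw [hu]; field_simp,
    show N * ((z + i * π) / N) = z + i * π by field_simp] at h1
  have h2 : |sin (z + i * π)| = sin z := by
    rw [sin_add_nat_mul_pi, abs_mul, abs_pow, abs_neg, abs_one, one_pow, one_mul, abs_of_nonneg hsz]
  have h3 : 2 * sin u * |trapCos N ((z + i * π) / N)| = sin z * cos u := by
    have := congrArg abs h1
    rwa [abs_mul, abs_mul, abs_mul, h2, abs_of_pos hs, abs_two, abs_of_nonneg hc] at this
  have h4 := mul_cos_le_sin_mul hu0.le hu1
  have h5 : N / (z + i * π) - (z + i * π) / (12 * N) = (1 - u ^ 2 / 3) / (2 * u) := by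
    rw [hu]
    have : 0 < z + i * π := by positivity
    field_simp
    ring
  rw [h5]
  have h6 : cos u ≤ (1 - u ^ 2 / 3) / u * sin u := by
    rw [div_mul_eq_mul_div, le_div_iff₀ hu0]; linarith
  have h7 : 2 * sin u * |trapCos N ((z + i * π) / N)| ≤
      2 * sin u * (sin z * ((1 - u ^ 2 / 3) / (2 * u))) := by
    rw [h3]
    calc sin z * cos u ≤ sin z * ((1 - u ^ 2 / 3) / u * sin u) := by gcongr
      _ = _ := by field_simp
  exact le_of_mul_le_mul_left h7 (by positivity)

/-- With `s = sin z`, `w = z - π / 2` and `a = (2 i + 1) π / 2`, the left-hand side is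
`sin z * (1 / (a + w) + 1 / (a - w))`, which is largest at the midpoint `w = 0`. -/
lemma reciprocal_pair_le {a w s : ℝ} (ha : π / 2 ≤ a) (hw : w ^ 2 ≤ (1 - s) * (π ^ 2 / 4))
    (hs1 : s ≤ 1) (haw : w ^ 2 < a ^ 2) : s * (2 * a / (a ^ 2 - w ^ 2)) ≤ 2 / a := by
  have hpi := pi_pos
  have ha0 : 0 < a := by linarith
  rw [← mul_div_assoc, div_le_iff₀ (by linarith)]
  have e4 : 2 / a * (a ^ 2 - w ^ 2) = 2 * a - 2 / a * w ^ 2 := by field_simp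
  rw [e4]
  have e5 : w ^ 2 ≤ (1 - s) * a ^ 2 := by
    refine hw.trans ?_
    have : π ^ 2 / 4 ≤ a ^ 2 := by
      have := pow_le_pow_left₀ (by positivity) ha 2
      linarith [this, show (π / 2) ^ 2 = π ^ 2 / 4 by ring]
    exact mul_le_mul_of_nonneg_left this (by linarith)
  have e6 : 2 / a * w ^ 2 ≤ 2 / a * ((1 - s) * a ^ 2) := by gcongr
  have e7 : 2 / a * ((1 - s) * a ^ 2) = 2 * a - s * (2 * a) := by field_simp
  linarith

/-- For `a = 3 π / 2` there is room to spare in `reciprocal_pair_le`, proportional to `1 - sin z`. -/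
lemma reciprocal_pair_le_sub {a w s : ℝ} (hw : w ^ 2 ≤ (1 - s) * (π ^ 2 / 4)) (hs1 : s ≤ 1)
    (ha : a = 3 * π / 2) (haw : w ^ 2 < a ^ 2) :
    s * (2 * a / (a ^ 2 - w ^ 2)) ≤ 2 / a - π / 12 * (1 - s) := by
  have hpi := pi_pos
  have ha0 : 0 < a := by rw [ha]; positivity
  have hpi2 : π ^ 2 ≤ 10 := by nlinarith [pi_lt_d2, pi_gt_three]
  have hs : 0 ≤ (1 - s) * π := mul_nonneg (by linarith) hpi.le
  rw [← mul_div_assoc, div_le_iff₀ (by linarith)]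
  have e4 : (2 / a - π / 12 * (1 - s)) * (a ^ 2 - w ^ 2) =
      2 * a - 2 / a * w ^ 2 - π / 12 * (1 - s) * a ^ 2 + π / 12 * (1 - s) * w ^ 2 := by
    field_simp
    ring
  rw [e4]
  have e5 : 2 / a * w ^ 2 ≤ 2 / a * ((1 - s) * (π ^ 2 / 4)) := by gcongr
  have e6 : 2 / a * ((1 - s) * (π ^ 2 / 4)) = (1 - s) * π / 3 := by
    rw [ha]; field_simp; ring
  have e7 : 0 ≤ π / 12 * (1 - s) * w ^ 2 := by
    have : 0 ≤ 1 - s := by linarith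
    positivity
  have e8 : π / 12 * (1 - s) * a ^ 2 ≤ (1 - s) * π * (15 / 8) := by
    calc π / 12 * (1 - s) * a ^ 2 = (1 - s) * π * (3 / 16 * π ^ 2) := by rw [ha]; ring
      _ ≤ (1 - s) * π * (15 / 8) := by
        apply mul_le_mul_of_nonneg_left _ hs; linarith
  have e9 : s * (2 * a) = 2 * a - 3 * ((1 - s) * π) := by rw [ha]; ring
  rw [e9]
  linarith

/-- The term `i = 1` compensates for the loss of `sin z` in the correction `- π / 12`. -/
lemma sum_abs_trapCos_le {N : ℕ} (hN : 2 ≤ N) {z : ℝ} (h0 : 0 < z) (hz : z < π) :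
    (∑ i ∈ range (2 * N), |trapCos N ((z + i * π) / N)|) / N ≤ lebesgueBound N := by
  have hpi := pi_pos
  have hN0 : (0 : ℝ) < N := by positivity
  -- the points of index `i` and `2 N - 1 - i` are paired: they are mirror images for `z ↦ π - z`
  have hsplit : ∑ i ∈ range (2 * N), |trapCos N ((z + i * π) / N)| =
      ∑ i ∈ range N, (|trapCos N ((z + i * π) / N)| + |trapCos N ((π - z + i * π) / N)|) := by
    rw [two_mul, Finset.sum_range_add, Finset.sum_add_distrib]
    congr 1
    rw [← Finset.sum_range_reflect]
    refine Finset.sum_congr rfl fun i hi => ?_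
    rw [mem_range] at hi
    rw [← trapCos_neg, ← trapCos_add_two_pi, show N - 1 - i = N - (i + 1) by omega]
    congr 2
    rw [Nat.cast_add, Nat.cast_sub (by omega)]
    push_cast; field_simp; ring
  set s := sin z with hs
  have hs0 : 0 ≤ s := sin_nonneg_of_nonneg_of_le_pi h0.le hz.le
  have hs1 : s ≤ 1 := sin_le_one z
  have hpar := sin_le_parabola h0.le hz.le
  rw [← hs] at hpar
  set w := z - π / 2 with hw
  have hw2 : w ^ 2 < (π / 2) ^ 2 := by
    rw [sq_lt_sq, abs_of_pos (by positivity : 0 < π / 2), abs_lt]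
    constructor <;> linarith
  have hterm : ∀ i ∈ range N, (|trapCos N ((z + i * π) / N)| + |trapCos N ((π - z + i * π) / N)|) / N ≤
      4 / (π * (2 * i + 1)) - (if i = 1 then π / 12 * (1 - s) else 0) -
        s * π / (12 * N ^ 2) * (2 * i + 1) := by
    intro i hi
    rw [mem_range] at hi
    have e1 := abs_trapCos_le (by omega) h0 hz hi
    have e2 := abs_trapCos_le (N := N) (by omega) (z := π - z) (by linarith) (by linarith) hi
    rw [sin_pi_sub] at e2
    set a : ℝ := (2 * i + 1) * (π / 2) with ha
    have ha0 : 0 < a := by positivity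
    have haw : π / 2 ≤ a := by
      rw [ha]; nlinarith [(Nat.cast_nonneg i : (0:ℝ) ≤ i)]
    have haw2 : w ^ 2 < a ^ 2 := hw2.trans_le (pow_le_pow_left₀ (by positivity) haw 2)
    have z1 : z + i * π = a + w := by rw [ha, hw]; ring
    have z2 : π - z + i * π = a - w := by rw [ha, hw]; ring
    have p1 : 0 < a + w := by rw [← z1]; positivity
    have p2 : 0 < a - w := by
      rw [← z2]; have : 0 < π - z := by linarith
      positivity
    have e3 : (|trapCos N ((z + i * π) / N)| + |trapCos N ((π - z + i * π) / N)|) / N ≤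
        s * (2 * a / (a ^ 2 - w ^ 2)) - s * π / (12 * N ^ 2) * (2 * i + 1) := by
      rw [div_le_iff₀ hN0]
      refine (add_le_add e1 e2).trans (le_of_eq ?_)
      rw [z1, z2, show a ^ 2 - w ^ 2 = (a + w) * (a - w) by ring, ← hs]
      have : s * π / (12 * N ^ 2) * (2 * i + 1) = s * (2 * a) / (12 * N ^ 2) := by rw [ha]; ring
      rw [this]
      field_simp
      ring
    refine e3.trans ?_
    have hda : 4 / (π * (2 * i + 1)) = 2 / a := by rw [ha]; field_simp; ring
    rw [hda]
    refine sub_le_sub_right ?_ _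
    have hwd : w ^ 2 ≤ (1 - s) * (π ^ 2 / 4) := by
      have : 4 / π ^ 2 * w ^ 2 ≤ 1 - s := by linarith
      calc w ^ 2 = 4 / π ^ 2 * w ^ 2 * (π ^ 2 / 4) := by field_simp
        _ ≤ _ := by gcongr
    split_ifs with h1
    · subst h1
      exact reciprocal_pair_le_sub hwd hs1 (by rw [ha]; push_cast; ring) haw2
    · rw [sub_zero]
      exact reciprocal_pair_le haw hwd hs1 haw2
  rw [hsplit, Finset.sum_div]
  refine (Finset.sum_le_sum hterm).trans (le_of_eq ?_)
  rw [Finset.sum_sub_distrib, Finset.sum_sub_distrib, Finset.sum_ite_eq', if_pos (by simp; omega),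
    ← Finset.mul_sum]
  have hodd : ∑ i ∈ range N, (2 * (i : ℝ) + 1) = N ^ 2 := by
    clear * -
    induction N with
    | zero => simp
    | succ n ih => rw [Finset.sum_range_succ, ih]; push_cast; ring
  rw [hodd, lebesgueBound]
  field_simp
  ring

lemma lebesgueBound_three : lebesgueBound 3 ^ 2 ≤ 2.95 := by
  have h1 := pi_gt_d4
  have h2 := pi_lt_d4
  have e : lebesgueBound 3 = 92 / 15 * (1 / π) - π / 12 := by
    simp only [lebesgueBound, Finset.sum_range_succ, Finset.sum_range_zero]
    have := pi_pos
    field_simp; norm_num; ring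
  have h3 : 1 / π ≤ 0.31832 := by
    rw [div_le_iff₀ pi_pos]; nlinarith
  have h4 : 0.318 ≤ 1 / π := by
    rw [le_div_iff₀ pi_pos]; nlinarith
  have h5 : lebesgueBound 3 ≤ 1.7 := by rw [e]; linarith
  have h6 : 0 ≤ lebesgueBound 3 := by rw [e]; linarith
  nlinarith

lemma lebesgueBound_sq_le {N : ℕ} (hN : 4 ≤ N) :
    0 ≤ lebesgueBound N ∧ lebesgueBound N ^ 2 ≤ 0.9 * N := by
  have h1 := pi_gt_d4
  have h2 := pi_lt_d4
  have h3 : 1 / π ≤ 0.31832 := by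
    rw [div_le_iff₀ pi_pos]; nlinarith
  have h4 : 0.318 ≤ 1 / π := by
    rw [le_div_iff₀ pi_pos]; nlinarith
  induction N, hN using Nat.le_induction with
  | base =>
    have e : lebesgueBound 4 = 704 / 105 * (1 / π) - π / 12 := by
      simp only [lebesgueBound, Finset.sum_range_succ, Finset.sum_range_zero]
      have := pi_pos
      field_simp; norm_num; ring
    have h5 : lebesgueBound 4 ≤ 1.89 := by rw [e]; linarith
    have h6 : 0 ≤ lebesgueBound 4 := by rw [e]; linarith
    refine ⟨h6, ?_⟩
    norm_num
    nlinarith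
  | succ n hn ih =>
    obtain ⟨ih0, ih1⟩ := ih
    have hn' : (4 : ℝ) ≤ n := by exact_mod_cast hn
    have e : lebesgueBound (n + 1) = lebesgueBound n + 4 * (1 / π) / (2 * n + 1) := by
      rw [lebesgueBound, lebesgueBound, Finset.sum_range_succ]
      field_simp; ring
    set d := 4 * (1 / π) / (2 * (n : ℝ) + 1) with hd
    have hd0 : 0 ≤ d := by positivity
    have hd1 : d * (2 * n + 1) ≤ 1.28 := by
      rw [hd, div_mul_cancel₀ _ (by positivity)]; linarith
    have hd2 : d ≤ 0.15 := by nlinarith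
    rw [e]
    refine ⟨by positivity, ?_⟩
    set G := lebesgueBound n
    have hG : G ≤ 0.225 * n + 1 := by nlinarith [sq_nonneg (G - 2)]
    have : 2 * G * d ≤ 2 * (0.225 * n + 1) * d := by gcongr
    push_cast
    nlinarith

/-! ### Univariate error and interpolation functionals -/

/-- `g` is holomorphic on the Bernstein ellipse of parameter `ϱ` and bounded there by `W`. -/
def IsBoundedHolo (ϱ W : ℝ) (g : ℂ → ℂ) : Prop :=
  DifferentiableOn ℂ g (bernsteinEllipse ϱ) ∧ ∀ z ∈ bernsteinEllipse ϱ, ‖g z‖ ≤ W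

/-- Univariate Chebyshev interpolation of degree `N` of a complex-valued function. -/
def univInterp (N : ℕ) (g : ℂ → ℂ) (y : ℝ) : ℂ :=
  ∑ k ∈ range (N + 1), (cardinal N k y : ℂ) * g (node N k : ℂ)

/-- The interpolation error on `[-1, 1]` of any bounded holomorphic `g` is at most `e` times the bound
of `g` on the ellipse. -/
def ErrorBound (ϱ : ℝ) (N : ℕ) (e : ℝ) : Prop :=
  ∀ (g : ℂ → ℂ) (W : ℝ), IsBoundedHolo ϱ W g → ∀ y ∈ Set.Icc (-1 : ℝ) 1,
    ‖g y - univInterp N g y‖ ≤ e * W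

/-- The interpolant on `[-1, 1]` of any bounded holomorphic `g` is at most `L` times the bound of `g` on
the ellipse. This may hold with `L` smaller than the Lebesgue constant. -/
def InterpBound (ϱ : ℝ) (N : ℕ) (L : ℝ) : Prop :=
  ∀ (g : ℂ → ℂ) (W : ℝ), IsBoundedHolo ϱ W g → ∀ y ∈ Set.Icc (-1 : ℝ) 1,
    ‖univInterp N g y‖ ≤ L * W

lemma IsBoundedHolo.nonneg {ϱ W : ℝ} {g : ℂ → ℂ} (hϱ : 1 < ϱ) (h : IsBoundedHolo ϱ W g) : 0 ≤ W :=
  (norm_nonneg _).trans (h.2 _ (ofReal_mem_bernsteinEllipse hϱ (y := 0) (by simp)))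

lemma node_eq (N k : ℕ) : node N k = cos (k * (π / N)) := by
  rw [node]; congr 1; ring

lemma node_mem_Icc (N k : ℕ) : node N k ∈ Set.Icc (-1 : ℝ) 1 := cos_mem_Icc _

/-- Interpolation acts on a Chebyshev series by folding the degrees onto `0, …, N`. -/
lemma hasSum_univInterp {N : ℕ} (hN : 1 ≤ N) {g : ℂ → ℂ} {a : ℕ → ℂ}
    (ha : ∀ θ : ℝ, HasSum (fun j : ℕ => a j * (cos (j * θ) : ℂ)) (g (cos θ : ℂ))) (θ : ℝ) :
    HasSum (fun j : ℕ => a j * ((cos (aliasIndex N j * θ) : ℝ) : ℂ)) (univInterp N g (cos θ)) := by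
  have h1 : HasSum (fun j : ℕ => ∑ k ∈ range (N + 1), (cardinal N k (cos θ) : ℂ) *
      (a j * ((cos (j * (k * (π / N))) : ℝ) : ℂ))) (univInterp N g (cos θ)) := by
    refine hasSum_sum fun k _ => ?_
    rw [node_eq]
    exact (by simpa using ha (k * (π / N)) : HasSum _ _).mul_left _
  refine h1.congr_fun fun j => ?_
  rw [← sum_cardinal_mul_cos hN j θ, Complex.ofReal_sum, Finset.mul_sum]
  refine Finset.sum_congr rfl fun k _ => ?_
  push_cast
  ring

/-- Cauchy–Schwarz against the Hardy-type norm: `√B` bounds the norm of the functional `φ`. -/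
lemma norm_le_mul_sqrt_of_hardy {q W B : ℝ} (hq : 0 < q) (hW : 0 ≤ W) {a : ℕ → ℂ}
    (ha : ∀ n, ∑ j ∈ range n, ‖a j‖ ^ 2 / hardyWeight q j ≤ W ^ 2) {φ : ℕ → ℝ}
    (hφ : ∀ n, ∑ j ∈ range n, hardyWeight q j * φ j ^ 2 ≤ B) {s : ℂ}
    (h : HasSum (fun j => a j * (φ j : ℂ)) s) : ‖s‖ ≤ √B * W := by
  have hB : 0 ≤ B := by simpa using hφ 0
  refine le_of_tendsto h.tendsto_sum_nat.norm (Filter.Eventually.of_forall fun n => ?_)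
  have h1 : ‖∑ j ∈ range n, a j * (φ j : ℂ)‖ ≤ ∑ j ∈ range n, ‖a j‖ * |φ j| := by
    refine (norm_sum_le _ _).trans (le_of_eq (Finset.sum_congr rfl fun j _ => ?_))
    rw [norm_mul, Complex.norm_real, norm_eq_abs]
  have h2 : (∑ j ∈ range n, ‖a j‖ * |φ j|) ^ 2 ≤
      (∑ j ∈ range n, ‖a j‖ ^ 2 / hardyWeight q j) * ∑ j ∈ range n, hardyWeight q j * φ j ^ 2 := by
    apply Finset.sum_sq_le_sum_mul_sum_of_sq_le_mul
    · intro j _; have := hardyWeight_pos hq j; positivity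
    · intro j _; have := hardyWeight_pos hq j; positivity
    · intro j _
      have := (hardyWeight_pos hq j).ne'
      refine le_of_eq ?_
      rw [mul_pow, sq_abs]
      field_simp
  have h3 : (∑ j ∈ range n, ‖a j‖ * |φ j|) ^ 2 ≤ (√B * W) ^ 2 := by
    refine h2.trans ?_
    rw [mul_pow, sq_sqrt hB, mul_comm B]
    have := hφ n
    exact mul_le_mul (ha n) this
      (Finset.sum_nonneg fun j _ => by have := hardyWeight_pos hq j; positivity) (by positivity)
  exact h1.trans (le_of_sq_le_sq h3 (by positivity))

/-- The sum over all `u` is `(q / (1 - q) - Re (z / (1 - z))) / 2` with `z = q exp (2 i θ)`, which is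
largest for `z = -q`. -/
lemma sum_geometric_mul_sin_sq_le {q : ℝ} (hq0 : 0 < q) (hq1 : q < 1) (θ : ℝ) (n : ℕ) :
    ∑ u ∈ range n, q ^ (u + 1) * sin ((u + 1 : ℕ) * θ) ^ 2 ≤ q / (1 - q ^ 2) := by
  set z : ℂ := q * Complex.exp ((2 * θ : ℝ) * Complex.I) with hz
  have hzn : ‖z‖ = q := by
    rw [hz, norm_mul, Complex.norm_exp_ofReal_mul_I, mul_one, Complex.norm_real, norm_eq_abs,
      abs_of_pos hq0]
  have hzre : z.re = q * cos (2 * θ) := by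
    rw [hz, Complex.re_ofReal_mul, Complex.exp_ofReal_mul_I_re]
  have hpow : ∀ m : ℕ, (z ^ m).re = q ^ m * cos (m * (2 * θ)) := by
    intro m
    rw [hz, mul_pow, ← Complex.exp_nat_mul, ← Complex.ofReal_pow, Complex.re_ofReal_mul]
    congr 1
    rw [← Complex.exp_ofReal_mul_I_re]
    congr 2
    push_cast; ring
  have h1 : HasSum (fun u : ℕ => z ^ (u + 1)) (z * (1 - z)⁻¹) := by
    simp_rw [pow_succ']
    exact (hasSum_geometric_of_norm_lt_one (by rw [hzn]; exact hq1)).mul_left z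
  have h2 : HasSum (fun u : ℕ => q ^ (u + 1)) (q * (1 - q)⁻¹) := by
    simp_rw [pow_succ']
    exact (hasSum_geometric_of_lt_one hq0.le hq1).mul_left q
  have h3 : HasSum (fun u : ℕ => q ^ (u + 1) * sin ((u + 1 : ℕ) * θ) ^ 2)
      ((q * (1 - q)⁻¹ - (z * (1 - z)⁻¹).re) / 2) := by
    refine ((h2.sub (Complex.hasSum_re h1)).div_const 2).congr_fun fun u => ?_
    rw [hpow, sin_sq_eq_half_sub]
    rw [show ((u + 1 : ℕ) : ℝ) * (2 * θ) = 2 * ((u + 1 : ℕ) * θ) by ring]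
    ring
  refine (sum_le_hasSum _ (fun u _ => by positivity) h3).trans ?_
  have hre : -(q / (1 + q)) ≤ (z * (1 - z)⁻¹).re := by
    have hns : Complex.normSq (1 - z) = 1 - 2 * (q * cos (2 * θ)) + q ^ 2 := by
      rw [Complex.normSq_sub, Complex.normSq_one, Complex.normSq_eq_norm_sq, hzn]
      simp [hzre]; ring
    have hpos : 0 < Complex.normSq (1 - z) := by
      rw [Complex.normSq_pos, sub_ne_zero]
      rintro h
      rw [← h] at hzn
      simp at hzn
      linarith
    have hval : (z * (1 - z)⁻¹).re = (q * cos (2 * θ) - q ^ 2) / Complex.normSq (1 - z) := by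
      have him : z.re * z.re + z.im * z.im = q ^ 2 := by
        rw [← hzn, ← Complex.normSq_eq_norm_sq, Complex.normSq_apply]
      rw [Complex.mul_re, Complex.inv_re, Complex.inv_im, ← him, ← hzre]
      simp
      ring
    rw [hval, ← neg_div, div_le_div_iff₀ (by linarith) hpos, hns]
    have := neg_one_le_cos (2 * θ)
    nlinarith [mul_nonneg hq0.le (mul_nonneg (by linarith : 0 ≤ 1 - q) (by linarith : 0 ≤ 1 + cos (2 * θ)))]
  have hfin : (q * (1 - q)⁻¹ + q / (1 + q)) / 2 = q / (1 - q ^ 2) := by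
    have e1 : 1 - q ≠ 0 := by linarith
    have e2 : 1 + q ≠ 0 := by linarith
    have e3 : 1 - q ^ 2 ≠ 0 := by
      rw [show 1 - q ^ 2 = (1 - q) * (1 + q) by ring]; exact mul_ne_zero e1 e2
    rw [show 1 - q ^ 2 = (1 - q) * (1 + q) by ring]
    field_simp
    ring
  linarith

lemma hardyWeight_of_ne_zero {q : ℝ} {j : ℕ} (hj : j ≠ 0) : hardyWeight q j = 4 * q ^ j := by
  rw [hardyWeight, if_neg hj]

/-- Summation by parts over consecutive blocks: the two halves of each block are regrouped with the
adjacent halves of its neighbours. -/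
lemma block_sum_le {X C : ℝ} (hX0 : 0 < X) (hX1 : X ≤ 1) (hC : 1 ≤ C) {S σ B : ℕ → ℝ}
    (hS0 : S 0 = 0)
    (hS : ∀ p, S (p + 1) = S p + 16 * X ^ (p + 1) * σ (p + 1) * (B p + B (p + 1)))
    (hσ0 : ∀ p, 0 ≤ σ p) (hσ1 : ∀ p, σ p ≤ 1) (hB0 : ∀ p, 0 ≤ B p) (h1 : σ 1 + X * σ 2 ≤ C)
    (h2 : X * (1 + X) ≤ 1) (P : ℕ) :
    S P + 16 * X ^ (P + 1) * σ (P + 1) * B P ≤ 16 * X * C * ∑ v ∈ range (P + 1), B v := by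
  induction P with
  | zero =>
    rw [hS0]
    simp only [zero_add, pow_one, Finset.sum_range_one]
    have := mul_le_mul_of_nonneg_left (mul_le_mul_of_nonneg_right ((hσ1 1).trans hC) (hB0 0))
      (by positivity : 0 ≤ 16 * X)
    linarith
  | succ P ih =>
    rw [hS, Finset.sum_range_succ]
    have hco : X ^ (P + 1) * (σ (P + 1) + X * σ (P + 2)) ≤ X * C := by
      rcases Nat.eq_zero_or_pos P with rfl | hP
      · rw [zero_add, zero_add, pow_one]
        exact mul_le_mul_of_nonneg_left h1 hX0.le
      · have e1 : X ^ P ≤ X := by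
          calc X ^ P ≤ X ^ 1 := pow_le_pow_of_le_one hX0.le hX1 hP
            _ = X := pow_one X
        have e2 : σ (P + 1) + X * σ (P + 2) ≤ 1 + X := by
          have := mul_le_mul_of_nonneg_left (hσ1 (P + 2)) hX0.le
          linarith [hσ1 (P + 1)]
        have e3 : 0 ≤ σ (P + 1) + X * σ (P + 2) := by
          have := hσ0 (P + 1); have := hσ0 (P + 2); positivity
        calc X ^ (P + 1) * (σ (P + 1) + X * σ (P + 2))
            = X ^ P * (σ (P + 1) + X * σ (P + 2)) * X := by ring
          _ ≤ X * (1 + X) * X := by gcongr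
          _ ≤ 1 * X := by gcongr
          _ ≤ X * C := by rw [mul_comm]; gcongr
    have := mul_le_mul_of_nonneg_right hco (hB0 (P + 1))
    have e4 : X ^ (P + 1 + 1) = X ^ (P + 1) * X := pow_succ _ _
    rw [e4]
    have e5 : P + 1 + 1 = P + 2 := rfl
    rw [e5]
    linarith

/-- The squared dual Hardy norm of the error functional `g ↦ g (cos θ) - univInterp N g (cos θ)`. The
hypotheses on `C` account for the overlap of consecutive aliasing blocks. -/
lemma aliasing_energy_le {N : ℕ} (hN : 1 ≤ N) {q C : ℝ} (hq0 : 0 < q) (hq1 : q < 1) (hC : 1 ≤ C)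
    (h1 : ∀ s ∈ Set.Icc (0 : ℝ) 1, s + q ^ N * (4 * s * (1 - s)) ≤ C)
    (h2 : q ^ N * (1 + q ^ N) ≤ 1) (θ : ℝ) (n : ℕ) :
    ∑ j ∈ range n, hardyWeight q j * (cos (j * θ) - cos (aliasIndex N j * θ)) ^ 2 ≤
      16 * q ^ N * C * (q / (1 - q ^ 2)) := by
  set X := q ^ N with hX
  have hX0 : 0 < X := by positivity
  set t : ℕ → ℝ := fun j => hardyWeight q j * (cos (j * θ) - cos (aliasIndex N j * θ)) ^ 2 with ht
  have ht0 : ∀ j, 0 ≤ t j := fun j => mul_nonneg (hardyWeight_pos hq0 j).le (sq_nonneg _)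
  set A : ℕ → ℝ := fun u => q ^ (u + 1) * sin ((u + 1 : ℕ) * θ) ^ 2 with hA
  have hA0 : ∀ u, 0 ≤ A u := fun u => by positivity
  set B : ℕ → ℝ := fun v => ∑ u ∈ range N, A (N * v + u) with hB
  have hB0 : ∀ v, 0 ≤ B v := fun v => Finset.sum_nonneg fun u _ => hA0 _
  set σ : ℕ → ℝ := fun p => sin (N * p * θ) ^ 2 with hσ
  have hσ0 : ∀ p, 0 ≤ σ p := fun p => sq_nonneg _
  have hσ1 : ∀ p, σ p ≤ 1 := fun p => sin_sq_le_one _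
  -- each aliasing block of length `2 N`, centred at `2 N (p + 1)`
  have hblock : ∀ p, ∑ u ∈ range (2 * N), t (N + 1 + 2 * N * p + u) =
      16 * X ^ (p + 1) * σ (p + 1) * (B p + B (p + 1)) := by
    intro p
    have hterm : ∀ u ∈ range (2 * N), t (N + 1 + 2 * N * p + u) =
        16 * X ^ (p + 1) * σ (p + 1) * A (N * p + u) := by
      intro u hu
      rw [mem_range] at hu
      simp only [ht, hA, hσ, hX]
      rw [hardyWeight_of_ne_zero (by omega), cos_sub_cos_aliasIndex (p := p + 1) hN
        (by rw [mul_add]; omega) (by rw [mul_add]; omega)]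
      have e : (((N + 1 + 2 * N * p + u : ℕ) : ℝ) - N * (p + 1 : ℕ)) = ((N * p + u + 1 : ℕ) : ℝ) := by
        push_cast; ring
      rw [e, show N + 1 + 2 * N * p + u = N * (p + 1) + (N * p + u + 1) by ring, pow_add, pow_mul]
      ring
    rw [Finset.sum_congr rfl hterm, ← Finset.mul_sum, two_mul, Finset.sum_range_add]
    congr 2
    refine Finset.sum_congr rfl fun u _ => ?_
    rw [← add_assoc, mul_add, mul_one]
  have hclaim : ∀ P, ∑ j ∈ range (N + 1 + 2 * N * P), t j + 16 * X ^ (P + 1) * σ (P + 1) * B P ≤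
      16 * X * C * ∑ v ∈ range (P + 1), B v := by
    refine block_sum_le (S := fun P => ∑ j ∈ range (N + 1 + 2 * N * P), t j) hX0
      (pow_le_one₀ hq0.le hq1.le) hC ?_ ?_ hσ0 hσ1 hB0 ?_ h2
    · refine Finset.sum_eq_zero fun j hj => ?_
      rw [mem_range] at hj
      simp only [ht]
      rw [aliasIndex_of_le (by omega)]; simp
    · intro P
      rw [← hblock, show N + 1 + 2 * N * (P + 1) = N + 1 + 2 * N * P + 2 * N by ring,
        Finset.sum_range_add]
    · have hs : σ 2 = 4 * σ 1 * (1 - σ 1) := by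
        simp only [hσ]
        rw [show (N : ℝ) * ((2 : ℕ) : ℝ) * θ = 2 * (N * (1 : ℕ) * θ) by push_cast; ring,
          sin_two_mul, mul_pow, mul_pow, cos_sq']
        ring
      rw [hs]
      exact h1 _ ⟨hσ0 1, hσ1 1⟩
  have h16 : 0 ≤ 16 * X * C := by
    have : 0 < C := by linarith
    positivity
  have hgeo : ∑ u ∈ range (N * (n + 1)), A u ≤ q / (1 - q ^ 2) :=
    sum_geometric_mul_sin_sq_le hq0 hq1 θ _
  have hBsum : ∀ P, ∑ v ∈ range P, B v = ∑ u ∈ range (N * P), A u := by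
    intro P
    induction P with
    | zero => simp
    | succ P ih => rw [Finset.sum_range_succ, ih, mul_add, mul_one, Finset.sum_range_add]
  change ∑ j ∈ range n, t j ≤ _
  clear_value X t A B σ
  calc ∑ j ∈ range n, t j ≤ ∑ j ∈ range (N + 1 + 2 * N * n), t j := by
        apply Finset.sum_le_sum_of_subset_of_nonneg
        · intro j hj
          rw [mem_range] at hj ⊢
          nlinarith
        · intro j _ _; exact ht0 j
    _ ≤ 16 * X * C * ∑ v ∈ range (n + 1), B v := by
        have := hclaim n
        have : 0 ≤ 16 * X ^ (n + 1) * σ (n + 1) * B n := by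
          exact mul_nonneg (mul_nonneg (mul_nonneg (by norm_num) (pow_nonneg hX0.le _)) (hσ0 _))
            (hB0 n)
        linarith
    _ ≤ _ := by
        rw [hBsum]
        exact mul_le_mul_of_nonneg_left hgeo h16

lemma sum_hardyWeight_le {q : ℝ} (hq0 : 0 < q) (hq1 : q < 1) (n : ℕ) :
    ∑ j ∈ range n, hardyWeight q j ≤ (1 + 3 * q) / (1 - q) := by
  have h1 : HasSum (fun j : ℕ => 4 * q ^ j) (4 * (1 - q)⁻¹) :=
    (hasSum_geometric_of_lt_one hq0.le hq1).mul_left 4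
  have h2 := h1.sub (hasSum_ite_eq (0 : ℕ) (3 : ℝ))
  have h3 : HasSum (hardyWeight q) (4 * (1 - q)⁻¹ - 3) := by
    refine h2.congr_fun fun j => ?_
    unfold hardyWeight
    rcases eq_or_ne j 0 with rfl | hj
    · norm_num
    · simp [hj]
  refine (sum_le_hasSum _ (fun j _ => (hardyWeight_pos hq0 j).le) h3).trans (le_of_eq ?_)
  have : 1 - q ≠ 0 := by linarith
  field_simp; ring

lemma sum_hardyWeight_tail_le {q : ℝ} (hq0 : 0 < q) (hq1 : q < 1) (N n : ℕ) :
    ∑ j ∈ range n, (if N < j then hardyWeight q j else 0) ≤ 4 * q ^ (N + 1) / (1 - q) := by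
  have h1 : HasSum (fun j : ℕ => 4 * q ^ (N + 1) * q ^ j) (4 * q ^ (N + 1) * (1 - q)⁻¹) :=
    (hasSum_geometric_of_lt_one hq0.le hq1).mul_left _
  rw [div_eq_mul_inv]
  refine le_trans ?_ (sum_le_hasSum (range n) (fun j _ => by positivity) h1)
  rw [← Finset.sum_filter]
  have : ∑ j ∈ (range n).filter (fun j => N < j), hardyWeight q j =
      ∑ j ∈ range (n - (N + 1)), 4 * q ^ (N + 1) * q ^ j := by
    symm
    refine Finset.sum_bij (fun j _ => N + 1 + j) ?_ ?_ ?_ ?_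
    · intro j hj; simp at hj ⊢; omega
    · intro i _ j _ h; omega
    · intro j hj
      simp at hj
      exact ⟨j - (N + 1), by simp; omega, by omega⟩
    · intro j _
      rw [hardyWeight_of_ne_zero (by omega), pow_add]; ring
  rw [this]
  exact Finset.sum_le_sum_of_subset_of_nonneg (Finset.range_mono (by omega))
    (fun j _ _ => by positivity)

/-- The squared dual Hardy norm of `g ↦ univInterp N g (cos θ) - α g (cos θ)`. Together with
`|g (cos θ)| ≤ W` it bounds the interpolant by less than the Lebesgue constant if `q` is small. -/
lemma shifted_energy_le {N : ℕ} {q α E : ℝ} (hq0 : 0 < q) (hq1 : q < 1) (hα0 : 0 ≤ α)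
    (hα1 : α ≤ 1) {θ : ℝ}
    (hE : ∀ n, ∑ j ∈ range n, hardyWeight q j * (cos (j * θ) - cos (aliasIndex N j * θ)) ^ 2 ≤ E)
    (n : ℕ) :
    ∑ j ∈ range n, hardyWeight q j * (cos (aliasIndex N j * θ) - α * cos (j * θ)) ^ 2 ≤
      (1 - α) ^ 2 * ((1 + 3 * q) / (1 - q)) + α * E +
        (1 - α) * (4 * q ^ (N + 1) / (1 - q)) := by
  have hterm : ∀ j ∈ range n,
      hardyWeight q j * (cos (aliasIndex N j * θ) - α * cos (j * θ)) ^ 2 ≤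
      (1 - α) ^ 2 * hardyWeight q j +
      α * (hardyWeight q j * (cos (j * θ) - cos (aliasIndex N j * θ)) ^ 2) +
      (1 - α) * (if N < j then hardyWeight q j else 0) := by
    intro j _
    have hw := (hardyWeight_pos hq0 j).le
    have hc : cos (aliasIndex N j * θ) ^ 2 ≤ 1 := cos_sq_le_one _
    split_ifs with h
    · have e : (cos (aliasIndex N j * θ) - α * cos (j * θ)) ^ 2 ≤
          α * (cos (j * θ) - cos (aliasIndex N j * θ)) ^ 2 + (1 - α) := by
        nlinarith [mul_nonneg (mul_nonneg hα0 (by linarith : 0 ≤ 1 - α)) (sq_nonneg (cos (j * θ)))]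
      have := mul_le_mul_of_nonneg_left e hw
      nlinarith [mul_nonneg (sq_nonneg (1 - α)) hw]
    · rw [aliasIndex_of_le (by omega)] at hc ⊢
      rw [sub_self]
      have : (cos (j * θ) - α * cos (j * θ)) ^ 2 ≤ (1 - α) ^ 2 := by
        rw [show cos (j * θ) - α * cos (j * θ) = (1 - α) * cos (j * θ) by ring, mul_pow]
        nlinarith [sq_nonneg (1 - α)]
      have := mul_le_mul_of_nonneg_left this hw
      nlinarith
  refine (Finset.sum_le_sum hterm).trans ?_
  rw [Finset.sum_add_distrib, Finset.sum_add_distrib, ← Finset.mul_sum, ← Finset.mul_sum,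
    ← Finset.mul_sum]
  have h1 := mul_le_mul_of_nonneg_left (sum_hardyWeight_le hq0 hq1 n) (sq_nonneg (1 - α))
  have h2 := mul_le_mul_of_nonneg_left (hE n) hα0
  have h3 := mul_le_mul_of_nonneg_left (sum_hardyWeight_tail_le hq0 hq1 N n)
    (by linarith : 0 ≤ 1 - α)
  linarith

section Functionals

variable {ϱ : ℝ} {N : ℕ}

lemma inv_sq_pos_lt_one (hϱ : 1 < ϱ) : 0 < (ϱ ^ 2)⁻¹ ∧ (ϱ ^ 2)⁻¹ < 1 :=
  ⟨by positivity, inv_lt_one_of_one_lt₀ (one_lt_pow₀ hϱ two_ne_zero)⟩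

lemma errorBound_of_energy (hϱ : 1 < ϱ) (hN : 1 ≤ N) {E : ℝ}
    (hE : ∀ θ n, ∑ j ∈ range n, hardyWeight ((ϱ ^ 2)⁻¹) j *
      (cos (j * θ) - cos (aliasIndex N j * θ)) ^ 2 ≤ E) : ErrorBound ϱ N √E := by
  intro g W hg y hy
  obtain ⟨a, ha, hb⟩ := exists_chebyshev_expansion hϱ hg.1 hg.2
  obtain ⟨θ, rfl⟩ : ∃ θ, cos θ = y := ⟨arccos y, cos_arccos hy.1 hy.2⟩
  refine norm_le_mul_sqrt_of_hardy (inv_sq_pos_lt_one hϱ).1 (hg.nonneg hϱ) hb (hE θ) ?_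
  refine ((ha θ).sub (hasSum_univInterp hN ha θ)).congr_fun fun j => ?_
  push_cast
  ring

lemma interpBound_of_energy (hϱ : 1 < ϱ) (hN : 1 ≤ N) {α E : ℝ} (hα0 : 0 ≤ α)
    (hE : ∀ θ n, ∑ j ∈ range n, hardyWeight ((ϱ ^ 2)⁻¹) j *
      (cos (aliasIndex N j * θ) - α * cos (j * θ)) ^ 2 ≤ E) : InterpBound ϱ N (α + √E) := by
  intro g W hg y hy
  obtain ⟨a, ha, hb⟩ := exists_chebyshev_expansion hϱ hg.1 hg.2
  have hgy := hg.2 _ (ofReal_mem_bernsteinEllipse hϱ hy)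
  obtain ⟨θ, rfl⟩ : ∃ θ, cos θ = y := ⟨arccos y, cos_arccos hy.1 hy.2⟩
  have h1 : ‖univInterp N g (cos θ) - α * g (cos θ : ℝ)‖ ≤ √E * W := by
    refine norm_le_mul_sqrt_of_hardy (inv_sq_pos_lt_one hϱ).1 (hg.nonneg hϱ) hb (hE θ) ?_
    refine ((hasSum_univInterp hN ha θ).sub ((ha θ).mul_left (α : ℂ))).congr_fun fun j => ?_
    push_cast
    ring
  have h2 : ‖(α : ℂ) * g (cos θ : ℝ)‖ ≤ α * W := by
    rw [norm_mul, Complex.norm_real, norm_eq_abs, abs_of_nonneg hα0]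
    gcongr
  calc ‖univInterp N g (cos θ)‖
      = ‖α * g (cos θ : ℝ) + (univInterp N g (cos θ) - α * g (cos θ : ℝ))‖ := by ring_nf
    _ ≤ α * W + √E * W := (norm_add_le _ _).trans (add_le_add h2 h1)
    _ = _ := by ring

lemma errorBound_of_interpBound (hϱ : 1 < ϱ) {L : ℝ} (hL : InterpBound ϱ N L) :
    ErrorBound ϱ N (1 + L) := by
  intro g W hg y hy
  calc _ ≤ ‖g y‖ + ‖univInterp N g y‖ := norm_sub_le _ _
    _ ≤ W + L * W := add_le_add (hg.2 _ (ofReal_mem_bernsteinEllipse hϱ hy)) (hL g W hg y hy)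
    _ = _ := by ring

lemma norm_univInterp_le_of_sum_abs_cardinal (hϱ : 1 < ϱ) {g : ℂ → ℂ} {W L y : ℝ}
    (hg : IsBoundedHolo ϱ W g) (h : ∑ k ∈ range (N + 1), |cardinal N k y| ≤ L) :
    ‖univInterp N g y‖ ≤ L * W := by
  have hW := hg.nonneg hϱ
  calc ‖univInterp N g y‖ ≤ ∑ k ∈ range (N + 1), |cardinal N k y| * W := by
        refine (norm_sum_le _ _).trans (Finset.sum_le_sum fun k _ => ?_)
        rw [norm_mul, Complex.norm_real, norm_eq_abs]
        gcongr
        exact hg.2 _ (ofReal_mem_bernsteinEllipse hϱ (node_mem_Icc N k))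
    _ ≤ L * W := by
        rw [← Finset.sum_mul]
        exact mul_le_mul_of_nonneg_right h hW

lemma interpBound_lebesgue (hϱ : 1 < ϱ) (hN : 2 ≤ N) {L : ℝ} (h1 : 1 ≤ L)
    (h2 : lebesgueBound N ≤ L) : InterpBound ϱ N L := by
  intro g W hg y hy
  have hN0 : (0 : ℝ) < N := by positivity
  have hW := hg.nonneg hϱ
  obtain ⟨θ, rfl⟩ : ∃ θ, cos θ = y := ⟨arccos y, cos_arccos hy.1 hy.2⟩
  by_cases hs : sin (N * θ) = 0
  · -- at a node, the interpolant agrees with `g`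
    obtain ⟨a, ha, -⟩ := exists_chebyshev_expansion hϱ hg.1 hg.2
    have := hasSum_univInterp (by omega : 1 ≤ N) ha θ
    simp_rw [cos_aliasIndex_node (by omega : 1 ≤ N) _ hs] at this
    have e : univInterp N g (cos θ) = g (cos θ : ℝ) := by
      refine this.unique ?_
      simpa using ha θ
    rw [e]
    calc _ ≤ W := hg.2 _ (ofReal_mem_bernsteinEllipse hϱ hy)
      _ ≤ L * W := by nlinarith
  · set κ := ⌊N * θ / π⌋ with hκ
    set z := N * θ - κ * π with hz
    have hpi := pi_pos
    have hfl := Int.floor_le (N * θ / π)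
    have hfl2 := Int.lt_floor_add_one (N * θ / π)
    rw [← hκ, le_div_iff₀ hpi] at hfl
    rw [← hκ, div_lt_iff₀ hpi] at hfl2
    have hz0 : z ≠ 0 := by
      intro h
      apply hs
      rw [show N * θ = κ * π by linarith, sin_int_mul_pi]
    have hzpos : 0 < z := lt_of_le_of_ne (by linarith) (Ne.symm hz0)
    have hzlt : z < π := by linarith
    have hθ : θ = (z + κ * π) / N := by rw [hz]; field_simp; ring
    have hsum : ∑ k ∈ range (N + 1), |cardinal N k (cos θ)| ≤ L := by
      rw [hθ]
      exact ((sum_abs_cardinal_le (by omega) z κ).trans (sum_abs_trapCos_le hN hzpos hzlt)).trans h2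
    exact norm_univInterp_le_of_sum_abs_cardinal hϱ hg hsum

lemma interpBound_one (hϱ : 1 < ϱ) : InterpBound ϱ 1 1 := by
  intro g W hg y hy
  refine norm_univInterp_le_of_sum_abs_cardinal hϱ hg ?_
  simp [cardinal, Finset.sum_range_succ, halfWeight]
  rw [abs_of_nonneg (by linarith [hy.1]), abs_of_nonneg (by linarith [hy.2])]
  linarith

lemma interpBound_two (hϱ : 1 < ϱ) : InterpBound ϱ 2 (5 / 4) := by
  intro g W hg y hy
  refine norm_univInterp_le_of_sum_abs_cardinal hϱ hg ?_
  have e0 : cardinal 2 0 y = (y + y ^ 2) / 2 := by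
    simp [cardinal, Finset.sum_range_succ, halfWeight, Polynomial.Chebyshev.T_two]; ring
  have e1 : cardinal 2 1 y = 1 - y ^ 2 := by
    simp [cardinal, Finset.sum_range_succ, halfWeight, Polynomial.Chebyshev.T_two]
    rw [show π * 2⁻¹ = π / 2 by ring, cos_pi_div_two]
    simp
    rw [show 2 * π * 2⁻¹ = π by ring, cos_pi]
    ring
  have e2 : cardinal 2 2 y = (y ^ 2 - y) / 2 := by
    simp [cardinal, Finset.sum_range_succ, halfWeight, Polynomial.Chebyshev.T_two]; ring
  simp only [Finset.sum_range_succ, Finset.sum_range_zero, e0, e1, e2, zero_add]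
  rw [abs_of_nonneg (a := 1 - y ^ 2) (by nlinarith [hy.1, hy.2])]
  rcases le_total 0 y with h | h
  · rw [abs_of_nonneg (by positivity), abs_of_nonpos (by nlinarith [hy.2])]
    nlinarith [sq_nonneg (y - 1 / 2)]
  · rw [abs_of_nonpos (by nlinarith [hy.1]), abs_of_nonneg (by nlinarith)]
    nlinarith [sq_nonneg (y + 1 / 2)]

end Functionals

/-! ### Univariate constants -/

section CoefficientDecay

variable {ϱ : ℝ} {N : ℕ}

/-- The Hardy-type bound gives `‖a j‖ ≤ 2 W ϱ ^ (-j)`. -/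
lemma norm_le_of_sum_hardyWeight_le (hϱ : 1 < ϱ) {W : ℝ} (hW : 0 ≤ W) {a : ℕ → ℂ}
    (ha : ∀ n, ∑ j ∈ range n, ‖a j‖ ^ 2 / hardyWeight ((ϱ ^ 2)⁻¹) j ≤ W ^ 2) (j : ℕ) :
    ‖a j‖ ≤ 2 * W * ϱ⁻¹ ^ j := by
  have hw := hardyWeight_pos (inv_sq_pos_lt_one hϱ).1
  have h1 : ‖a j‖ ^ 2 / hardyWeight ((ϱ ^ 2)⁻¹) j ≤ W ^ 2 :=
    (Finset.single_le_sum (f := fun j => ‖a j‖ ^ 2 / hardyWeight ((ϱ ^ 2)⁻¹) j)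
      (fun i _ => div_nonneg (sq_nonneg _) (hw i).le) (Finset.self_mem_range_succ j)).trans
        (ha (j + 1))
  have h2 : hardyWeight ((ϱ ^ 2)⁻¹) j ≤ (2 * ϱ⁻¹ ^ j) ^ 2 := by
    rcases eq_or_ne j 0 with rfl | hj
    · norm_num [hardyWeight]
    · rw [hardyWeight_of_ne_zero hj, inv_pow, mul_pow, inv_pow, inv_pow, ← pow_mul, ← pow_mul,
        mul_comm j 2]
      norm_num
  rw [div_le_iff₀ (hw j)] at h1
  have : 0 ≤ ϱ⁻¹ ^ j := by positivity
  refine le_of_sq_le_sq (h1.trans ?_) (by positivity)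
  calc W ^ 2 * hardyWeight ((ϱ ^ 2)⁻¹) j ≤ W ^ 2 * (2 * ϱ⁻¹ ^ j) ^ 2 := by gcongr
    _ = _ := by ring

lemma errorBound_geometric (hϱ : 1 < ϱ) (hN : 1 ≤ N) :
    ErrorBound ϱ N (4 * (ϱ ^ (-(N : ℤ)) / (ϱ - 1))) := by
  intro g W hg y hy
  obtain ⟨a, ha, hb⟩ := exists_chebyshev_expansion hϱ hg.1 hg.2
  obtain ⟨θ, rfl⟩ : ∃ θ, cos θ = y := ⟨arccos y, cos_arccos hy.1 hy.2⟩
  have hW := hg.nonneg hϱ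
  have hr0 : 0 < ϱ⁻¹ := by positivity
  have hr1 : ϱ⁻¹ < 1 := inv_lt_one_of_one_lt₀ hϱ
  have h := (ha θ).sub (hasSum_univInterp hN ha θ)
  -- the terms of index at most `N` cancel
  have h' := (hasSum_nat_add_iff' (N + 1)).2 h
  rw [Finset.sum_eq_zero, sub_zero] at h'
  swap
  · intro j hj
    rw [aliasIndex_of_le (by rw [mem_range] at hj; omega)]
    push_cast
    ring
  have hgeo : HasSum (fun j : ℕ => 4 * W * ϱ⁻¹ ^ (N + 1) * ϱ⁻¹ ^ j)
      (4 * W * ϱ⁻¹ ^ (N + 1) * (1 - ϱ⁻¹)⁻¹) :=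
    (hasSum_geometric_of_lt_one hr0.le hr1).mul_left _
  have hval : 4 * W * ϱ⁻¹ ^ (N + 1) * (1 - ϱ⁻¹)⁻¹ = 4 * (ϱ ^ (-(N : ℤ)) / (ϱ - 1)) * W := by
    have : ϱ - 1 ≠ 0 := by linarith
    have : ϱ ≠ 0 := by linarith
    have h3 : 1 - ϱ⁻¹ = (ϱ - 1) / ϱ := by field_simp
    rw [h3, zpow_neg, zpow_natCast, pow_succ, inv_pow]
    field_simp
  rw [← hval]
  rw [← h'.tsum_eq]
  refine tsum_of_norm_bounded hgeo fun j => ?_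
  rw [← mul_sub, norm_mul]
  have h1 := norm_le_of_sum_hardyWeight_le hϱ hW hb (j + (N + 1))
  have h2 : ‖((cos ((j + (N + 1) : ℕ) * θ) : ℝ) : ℂ) -
      ((cos (aliasIndex N (j + (N + 1)) * θ) : ℝ) : ℂ)‖ ≤ 2 := by
    refine (norm_sub_le _ _).trans ?_
    rw [Complex.norm_real, Complex.norm_real, norm_eq_abs, norm_eq_abs]
    linarith [abs_cos_le_one ((j + (N + 1) : ℕ) * θ),
      abs_cos_le_one (aliasIndex N (j + (N + 1)) * θ)]
  calc _ ≤ 2 * W * ϱ⁻¹ ^ (j + (N + 1)) * 2 := by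
        refine mul_le_mul h1 h2 (norm_nonneg _) (by positivity)
    _ = _ := by rw [pow_add]; ring

lemma interpBound_geometric (hϱ : 1 < ϱ) (hN : 1 ≤ N) : InterpBound ϱ N (2 / (1 - 1 / ϱ)) := by
  intro g W hg y hy
  obtain ⟨a, ha, hb⟩ := exists_chebyshev_expansion hϱ hg.1 hg.2
  obtain ⟨θ, rfl⟩ : ∃ θ, cos θ = y := ⟨arccos y, cos_arccos hy.1 hy.2⟩
  have hW := hg.nonneg hϱ
  have hr0 : 0 < ϱ⁻¹ := by positivity
  have hr1 : ϱ⁻¹ < 1 := inv_lt_one_of_one_lt₀ hϱ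
  have hgeo : HasSum (fun j : ℕ => 2 * W * ϱ⁻¹ ^ j) (2 * W * (1 - ϱ⁻¹)⁻¹) :=
    (hasSum_geometric_of_lt_one hr0.le hr1).mul_left _
  have hval : 2 / (1 - 1 / ϱ) * W = 2 * W * (1 - ϱ⁻¹)⁻¹ := by rw [one_div]; ring
  rw [hval, ← (hasSum_univInterp hN ha θ).tsum_eq]
  refine tsum_of_norm_bounded hgeo fun j => ?_
  rw [norm_mul, Complex.norm_real, norm_eq_abs]
  calc _ ≤ 2 * W * ϱ⁻¹ ^ j * 1 :=
        mul_le_mul (norm_le_of_sum_hardyWeight_le hϱ hW hb j) (abs_cos_le_one _) (abs_nonneg _)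
          (by positivity)
    _ = _ := mul_one _

end CoefficientDecay

section QuadraticPair

variable {ϱ : ℝ} {N : ℕ}

lemma interpBound_sqrt (hϱ : 1 < ϱ) (hN : 2 ≤ N) {Λ : ℝ} (h1 : 1 ≤ Λ)
    (h2 : lebesgueBound N ^ 2 ≤ Λ) : InterpBound ϱ N √Λ :=
  interpBound_lebesgue hϱ hN (by rw [one_le_sqrt]; exact h1)
    ((le_abs_self _).trans (abs_le_sqrt h2))

/-- An upper bound for the squared Lebesgue constant of Chebyshev interpolation of degree `N ≥ 3`. -/
def lebesgueSq (N : ℕ) : ℝ := if N = 3 then 2.95 else 0.9 * N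

lemma interpBound_sqrt_lebesgueSq (hϱ : 1 < ϱ) (hN : 3 ≤ N) : InterpBound ϱ N √(lebesgueSq N) := by
  unfold lebesgueSq
  split_ifs with h
  · subst h
    exact interpBound_sqrt hϱ (by omega) (by norm_num) lebesgueBound_three
  · have hN4 : 4 ≤ N := by omega
    have : (4 : ℝ) ≤ N := by exact_mod_cast hN4
    exact interpBound_sqrt hϱ (by omega) (by linarith) (lebesgueBound_sq_le hN4).2

/-- The energy bound of `shifted_energy_le` with `α = 0.8` gives an interpolation bound `L` with
`L² ≤ 2 (1 + q²) / (1 - q²)`, provided that `q ≤ r` and `q ^ (N - 1) ≤ M` with small `r` and `M`. -/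
lemma exists_interpBound_of_shifted (hϱ : 1 < ϱ) (hN : 1 ≤ N) {q r M : ℝ} (hq : q = (ϱ ^ 2)⁻¹)
    (hX : q ^ N ≤ 1 / 4) (hr : q ≤ r) (hr1 : r ≤ 1) (hM : q ^ (N - 1) ≤ M)
    (h : (-3.3502 + M * (23.12 + 1.36 * r)) * r ^ 2 + 0.272 * r ≤ 0.3777) :
    ∃ L, 0 ≤ L ∧ InterpBound ϱ N L ∧ L ^ 2 ≤ 2 * (1 + q ^ 2) / (1 - q ^ 2) := by
  obtain ⟨hq0, hq1⟩ := inv_sq_pos_lt_one hϱ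
  rw [← hq] at hq0 hq1
  have hd : 0 < 1 - q ^ 2 := by nlinarith
  have hd1 : 0 < 1 - q := by linarith
  have hY0 : 0 < q ^ (N + 1) := by positivity
  set Y := q ^ (N + 1) with hY
  set P : ℝ := (1 - 0.8) ^ 2 * ((1 + 3 * q) / (1 - q)) + 0.8 * (16 * q ^ N * 1 * (q / (1 - q ^ 2))) +
        (1 - 0.8) * (4 * q ^ (N + 1) / (1 - q)) with hP
  have hP0 : 0 ≤ P := by
    have h1 : 0 ≤ (1 + 3 * q) / (1 - q) := div_nonneg (by linarith) hd1.le
    have h2 : 0 ≤ q / (1 - q ^ 2) := div_nonneg hq0.le hd.le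
    have h3 : 0 ≤ 4 * q ^ (N + 1) / (1 - q) := div_nonneg (by positivity) hd1.le
    rw [hP]
    have h4 : 0 ≤ q ^ N := by positivity
    have := mul_nonneg h4 h2
    nlinarith
  have hX0 : 0 < q ^ N := by positivity
  have hE := fun θ => aliasing_energy_le hN hq0 hq1 le_rfl
    (fun s hs => by nlinarith [mul_nonneg hs.1 (sub_nonneg.2 hs.2), sq_nonneg (1 - s)])
    (by nlinarith) θ
  refine ⟨0.8 + √P, by positivity, interpBound_of_energy hϱ hN (by norm_num) ?_, ?_⟩
  · rw [← hq]
    exact fun θ n => shifted_energy_le hq0 hq1 (by norm_num) (by norm_num) (hE θ) n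
  · have hs := sq_sqrt hP0
    -- Young's inequality with weight `0.7`: `1.6 √P ≤ 0.64 / 0.7 + 0.7 P`
    have h1 : (0.8 + √P) ^ 2 ≤ 0.64 * (17 / 7) + 1.7 * P := by
      nlinarith [sq_nonneg (0.8 - 0.7 * √P)]
    refine h1.trans ?_
    rw [le_div_iff₀ hd]
    have hPd : P * (1 - q ^ 2) = 0.04 * ((1 + 3 * q) * (1 + q)) + 12.8 * Y + 0.8 * Y * (1 + q) := by
      rw [hP, hY, pow_succ, show 1 - q ^ 2 = (1 - q) * (1 + q) by ring]
      have : 1 - q ≠ 0 := hd1.ne'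
      have : 1 + q ≠ 0 := by linarith
      field_simp
      ring
    have hYM : Y ≤ M * q ^ 2 := by
      rw [hY, show N + 1 = N - 1 + 2 by omega, pow_add]
      gcongr
    have hM0 : 0 ≤ M := le_trans (by positivity) hM
    have hYr : Y * (23.12 + 1.36 * q) ≤ M * (23.12 + 1.36 * r) * q ^ 2 := by
      calc Y * (23.12 + 1.36 * q) ≤ M * q ^ 2 * (23.12 + 1.36 * r) := by gcongr
        _ = _ := by ring
    have hfin : (-3.3502 + M * (23.12 + 1.36 * r)) * q ^ 2 + 0.272 * q ≤ 0.3777 := by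
      have hq2 : q ^ 2 ≤ r ^ 2 := by gcongr
      rcases le_total 0 (-3.3502 + M * (23.12 + 1.36 * r)) with hA | hA
      · have := mul_le_mul_of_nonneg_left hq2 hA
        linarith
      · have := mul_nonpos_of_nonpos_of_nonneg hA (sq_nonneg q)
        linarith
    have e : (0.64 * (17 / 7) + 1.7 * P) * (1 - q ^ 2) =
      0.64 * (17 / 7) * (1 - q ^ 2) + 1.7 * (P * (1 - q ^ 2)) := by ring
    rw [e, hPd]
    have := sq_nonneg q
    linarith

/-- `(1 - x) / (1 + x) ≤ exp (-2 x)`, in terms of a square. -/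
lemma le_exp_neg_of_sq_le {q x : ℝ} (hx0 : 0 ≤ x) (hx1 : x < 1)
    (h : q ^ 2 * (1 + x) ≤ 1 - x) : q ≤ exp (-x) := by
  have h1 := Real.hasSum_log_sub_log_of_abs_lt_one (x := x) (by rwa [abs_of_nonneg hx0])
  have h2 : 2 * x ≤ log (1 + x) - log (1 - x) := by
    have := sum_le_hasSum {0} (fun i _ => by positivity) h1
    simpa using this
  have h3 : exp (-x) ^ 2 = exp (-(2 * x)) := by rw [← exp_nat_mul]; ring_nf
  refine le_of_sq_le_sq ?_ (exp_pos _).le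
  rw [h3]
  have h4 : exp (-(log (1 + x) - log (1 - x))) = (1 - x) / (1 + x) := by
    rw [neg_sub, exp_sub, exp_log (by linarith), exp_log (by linarith)]
  calc q ^ 2 ≤ (1 - x) / (1 + x) := by rwa [le_div_iff₀ (by linarith)]
    _ ≤ exp (-(2 * x)) := by rw [← h4]; exact exp_le_exp.2 (by linarith)

/-- If `q ^ N` is small, the Lebesgue constant suffices for `q` close to `1`; otherwise `q` and thereby
`q ^ (N - 1)` are so small that the functional is close to `0.8 g (cos θ)`. -/
lemma exists_interpBound_of_pow_le (hϱ : 1 < ϱ) (hN : 1 ≤ N) {q : ℝ} (hq : q = (ϱ ^ 2)⁻¹)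
    (hX : q ^ N ≤ 1 / 4) :
    ∃ L, 0 ≤ L ∧ InterpBound ϱ N L ∧ L ^ 2 ≤ 2 * (1 + q ^ 2) / (1 - q ^ 2) := by
  obtain ⟨hq0, hq1⟩ := inv_sq_pos_lt_one hϱ
  rw [← hq] at hq0 hq1
  have hd : 0 < 1 - q ^ 2 := by nlinarith
  have hR : 2 ≤ 2 * (1 + q ^ 2) / (1 - q ^ 2) := by
    rw [le_div_iff₀ hd]; nlinarith
  rcases (by omega : N = 1 ∨ N = 2 ∨ 3 ≤ N) with rfl | rfl | hN3
  · exact ⟨1, zero_le_one, interpBound_one hϱ, by linarith⟩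
  · exact ⟨5 / 4, by norm_num, interpBound_two hϱ, by linarith⟩
  by_cases hl : lebesgueSq N ≤ 2 * (1 + q ^ 2) / (1 - q ^ 2)
  · refine ⟨√(lebesgueSq N), sqrt_nonneg _, interpBound_sqrt_lebesgueSq hϱ hN3, ?_⟩
    rwa [sq_sqrt (by unfold lebesgueSq; split_ifs <;> positivity)]
  rw [not_le, div_lt_iff₀ hd] at hl
  have key : ∀ r M : ℝ, 0 ≤ r → r ≤ 1 → q ^ 2 ≤ r ^ 2 → r ^ (N - 1) ≤ M →
      (-3.3502 + M * (23.12 + 1.36 * r)) * r ^ 2 + 0.272 * r ≤ 0.3777 →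
      ∃ L, 0 ≤ L ∧ InterpBound ϱ N L ∧ L ^ 2 ≤ 2 * (1 + q ^ 2) / (1 - q ^ 2) := by
    intro r M hr0 hr1 hqr hM h
    have hr : q ≤ r := le_of_sq_le_sq hqr hr0
    exact exists_interpBound_of_shifted hϱ hN hq hX hr hr1
      ((pow_le_pow_left₀ hq0.le hr _).trans hM) h
  rcases lt_or_ge N 10 with hN10 | hN10
  · -- each `r` is slightly above `√((Λ - 2) / (Λ + 2))` for `Λ = lebesgueSq N`,
    -- and each `M` slightly above `r ^ (N - 1)`
    interval_cases N <;> norm_num [lebesgueSq] at hl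
    · exact key 0.4385 0.1923 (by norm_num) (by norm_num) (by linarith) (by norm_num) (by norm_num)
    · exact key 0.535 0.1532 (by norm_num) (by norm_num) (by linarith) (by norm_num) (by norm_num)
    · exact key 0.621 0.1488 (by norm_num) (by norm_num) (by linarith) (by norm_num) (by norm_num)
    · exact key 0.678 0.1433 (by norm_num) (by norm_num) (by linarith) (by norm_num) (by norm_num)
    · exact key 0.72 0.1394 (by norm_num) (by norm_num) (by linarith) (by norm_num) (by norm_num)
    · exact key 0.752 0.1361 (by norm_num) (by norm_num) (by linarith) (by norm_num) (by norm_num)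
    · exact key 0.778 0.1343 (by norm_num) (by norm_num) (by linarith) (by norm_num) (by norm_num)
  · have hN' : (10 : ℝ) ≤ N := by exact_mod_cast hN10
    have hNpos : (0 : ℝ) < N := by linarith
    rw [lebesgueSq, if_neg (by omega)] at hl
    -- `q² ≤ (1 - x) / (1 + x)` with `x = 20 / (9 N)`, whence `q ^ (N - 1) ≤ exp (-2)` for `N ≥ 10`
    have hx1 : 20 / (9 * (N : ℝ)) < 1 := by rw [div_lt_one (by positivity)]; linarith
    have hqe : q ≤ exp (-(20 / (9 * (N : ℝ)))) := by
      refine le_exp_neg_of_sq_le (by positivity) hx1 ?_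
      have e1 : q ^ 2 * (1 + 20 / (9 * (N : ℝ))) * (9 * N) = q ^ 2 * (9 * N + 20) := by
        field_simp
      have e2 : (1 - 20 / (9 * (N : ℝ))) * (9 * N) = 9 * N - 20 := by field_simp
      refine le_of_mul_le_mul_right ?_ (by positivity : (0 : ℝ) < 9 * N)
      rw [e1, e2]
      linarith
    have hM : q ^ (N - 1) ≤ 0.1354 := by
      calc q ^ (N - 1) ≤ exp (-(20 / (9 * (N : ℝ)))) ^ (N - 1) := by gcongr
        _ = exp (-(20 * ((N : ℝ) - 1) / (9 * N))) := by
          rw [← exp_nat_mul, Nat.cast_sub hN, Nat.cast_one]; congr 1; ring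
        _ ≤ exp (-2) := by
          rw [exp_le_exp, neg_le_neg_iff, le_div_iff₀ (by positivity)]; linarith
        _ ≤ 0.1354 := by
          rw [exp_neg, show (2 : ℝ) = (2 : ℕ) * 1 by norm_num, exp_nat_mul]
          have h1 := exp_one_gt_d9
          have h2 : (2.7182 : ℝ) ^ 2 ≤ exp 1 ^ 2 := by gcongr; linarith
          calc (exp 1 ^ 2)⁻¹ ≤ ((2.7182 : ℝ) ^ 2)⁻¹ := by gcongr
            _ ≤ 0.1354 := by norm_num
    exact exists_interpBound_of_shifted hϱ hN hq hX hq1.le le_rfl hM (by norm_num)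

/-- A lower bound `exp (-t) ≤ q ^ N` forces `q` to lie within `t / N` of `1`. -/
lemma mul_one_sub_le_of_exp_le {q t : ℝ} (hq0 : 0 < q) (h : exp (-t) ≤ q ^ N) :
    N * (1 - q) ≤ t := by
  have h1 := log_le_log (exp_pos _) h
  rw [log_exp, log_pow] at h1
  have h2 := mul_le_mul_of_nonneg_left (log_le_sub_one_of_pos hq0) (Nat.cast_nonneg (α := ℝ) N)
  linarith

lemma exp_neg_le_quarter : exp (-1.3863) ≤ 1 / 4 := by
  have h := log_two_lt_d9
  have : exp (-1.3863) ≤ exp (-(2 * log 2)) := exp_le_exp.2 (by linarith)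
  refine this.trans (le_of_eq ?_)
  rw [exp_neg, two_mul, exp_add, exp_log two_pos]
  norm_num

lemma exp_neg_le_seven_twentieths : exp (-1.05) ≤ 0.35 := by
  have h1 := exp_one_gt_d9
  have h2 := quadratic_le_exp_of_nonneg (x := 0.05) (by norm_num)
  have h3 : (1 / 0.35 : ℝ) ≤ exp 1.05 := by
    rw [show (1.05 : ℝ) = 1 + 0.05 by norm_num, exp_add]
    calc (1 / 0.35 : ℝ) ≤ 2.7182818283 * (1 + 0.05 + 0.05 ^ 2 / 2) := by norm_num
      _ ≤ _ := by gcongr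
  rw [exp_neg]
  calc (exp 1.05)⁻¹ ≤ (1 / 0.35 : ℝ)⁻¹ := by gcongr
    _ = 0.35 := by norm_num

lemma exists_interpBound_of_lt_pow (hϱ : 1 < ϱ) (hN : 1 ≤ N) {q : ℝ} (hq : q = (ϱ ^ 2)⁻¹)
    (hX : 1 / 4 < q ^ N) :
    ∃ L, 0 ≤ L ∧ InterpBound ϱ N L ∧ 1 + L ^ 2 ≤ 2 / (1 - q) := by
  obtain ⟨hq0, hq1⟩ := inv_sq_pos_lt_one hϱ
  rw [← hq] at hq0 hq1
  have hd : 0 < 1 - q := by linarith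
  have hNq := mul_one_sub_le_of_exp_le hq0 (exp_neg_le_quarter.trans hX.le)
  rcases (by omega : N = 1 ∨ N = 2 ∨ 3 ≤ N) with rfl | rfl | hN3
  · refine ⟨1, zero_le_one, interpBound_one hϱ, ?_⟩
    rw [le_div_iff₀ hd]; linarith
  · refine ⟨5 / 4, by norm_num, interpBound_two hϱ, ?_⟩
    rw [le_div_iff₀ hd]; push_cast at hNq; linarith
  · refine ⟨√(lebesgueSq N), sqrt_nonneg _, interpBound_sqrt_lebesgueSq hϱ hN3, ?_⟩
    rw [sq_sqrt (by unfold lebesgueSq; split_ifs <;> positivity), le_div_iff₀ hd]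
    unfold lebesgueSq
    split_ifs with h
    · subst h; push_cast at hNq; linarith
    · have : (4 : ℝ) ≤ N := by exact_mod_cast (by omega : 4 ≤ N)
      nlinarith

/-- If `q ^ N` is not small, then `N (1 - q)` is bounded, and the square of the trivial error constant
`1 + L` is at most `8 q ^ N / (1 - q)`. For moderate `N` and `q ^ N ≤ 0.35` the aliasing energy, with
overlap constant `C = 36 / 35`, takes its place. -/
lemma errorBound_of_lt_pow (hϱ : 1 < ϱ) (hN : 1 ≤ N) {q : ℝ} (hq : q = (ϱ ^ 2)⁻¹)
    (hX : 1 / 4 < q ^ N) : ErrorBound ϱ N √(8 / (1 - q) * q ^ N) := by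
  obtain ⟨hq0, hq1⟩ := inv_sq_pos_lt_one hϱ
  rw [← hq] at hq0 hq1
  have hd : 0 < 1 - q := by linarith
  have hmono : ∀ {e : ℝ}, ErrorBound ϱ N e → e ≤ √(8 / (1 - q) * q ^ N) →
      ErrorBound ϱ N √(8 / (1 - q) * q ^ N) := fun he hle g W hg y hy =>
    (he g W hg y hy).trans (mul_le_mul_of_nonneg_right hle (hg.nonneg hϱ))
  have htriv : ∀ {L : ℝ}, InterpBound ϱ N L → 0 ≤ L → (1 + L) ^ 2 * (1 - q) ≤ 8 * q ^ N →
      ErrorBound ϱ N √(8 / (1 - q) * q ^ N) := by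
    intro L hL hL0 h
    refine hmono (errorBound_of_interpBound hϱ hL) (le_sqrt_of_sq_le ?_)
    rw [div_mul_eq_mul_div, le_div_iff₀ hd]
    exact h
  have htriv' : 3 ≤ N → (1 + 2 * √(lebesgueSq N) + lebesgueSq N) * (1 - q) ≤ 8 * q ^ N →
      ErrorBound ϱ N √(8 / (1 - q) * q ^ N) := by
    intro hN3 h
    refine htriv (interpBound_sqrt_lebesgueSq hϱ hN3) (sqrt_nonneg _) ?_
    have := sq_sqrt (by unfold lebesgueSq; split_ifs <;> positivity : 0 ≤ lebesgueSq N)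
    nlinarith
  rcases le_or_gt (q ^ N) 0.35 with h35 | h35
  · rcases le_or_gt N 15 with hN15 | hN15
    · have hq35 : q ≤ 35 / 37 := by
        by_contra! hlt
        have h1 : q ^ 15 ≤ q ^ N := pow_le_pow_of_le_one hq0.le hq1.le hN15
        have h2 : (35 / 37 : ℝ) ^ 15 ≤ q ^ 15 := by gcongr
        norm_num at h2 h35
        linarith
      have hE := fun θ => aliasing_energy_le hN hq0 hq1 (C := 36 / 35) (by norm_num)
        (fun s hs => by
          have := mul_nonneg hs.1 (sub_nonneg.2 hs.2)
          nlinarith [sq_nonneg (s - 6 / 7)]) (by nlinarith) θ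
      rw [hq] at hE
      refine hmono (errorBound_of_energy hϱ hN hE) (sqrt_le_sqrt ?_)
      rw [← hq, show 1 - q ^ 2 = (1 - q) * (1 + q) by ring, ← mul_div_assoc, div_mul_eq_mul_div,
        div_le_div_iff₀ (by positivity) hd]
      have : 0 ≤ q ^ N * (1 - q) := by positivity
      nlinarith
    · have hN16 : (16 : ℝ) ≤ N := by exact_mod_cast (by omega : 16 ≤ N)
      have hNq := mul_one_sub_le_of_exp_le hq0 (exp_neg_le_quarter.trans hX.le)
      refine htriv' (by omega) ?_
      rw [lebesgueSq, if_neg (by omega)]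
      -- the tangent at `N = 16`, where the estimate is nearly sharp: `√(0.9 * 16) ≈ 3.8`
      have hs : 2 * √(0.9 * N) ≤ 3.8 + 0.9 * N * (5 / 19) := by
        have := sq_sqrt (by positivity : 0 ≤ 0.9 * (N : ℝ))
        have := sq_nonneg (√(0.9 * N) - 3.8)
        linarith
      have : (1 + 2 * √(0.9 * N) + 0.9 * N) * (1 - q) ≤ 1.4426 * N * (1 - q) := by
        refine mul_le_mul_of_nonneg_right ?_ hd.le
        linarith
      linarith
  · have hNq := mul_one_sub_le_of_exp_le hq0 (exp_neg_le_seven_twentieths.trans h35.le)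
    rcases (by omega : N = 1 ∨ N = 2 ∨ 3 ≤ N) with rfl | rfl | hN3
    · refine htriv (interpBound_one hϱ) zero_le_one ?_
      rw [pow_one] at *
      linarith
    · refine htriv (interpBound_two hϱ) (by norm_num) ?_
      push_cast at hNq
      linarith
    · refine htriv' hN3 ?_
      unfold lebesgueSq
      split_ifs with h
      · subst h
        push_cast at hNq
        have : √2.95 ≤ 1.72 := sqrt_le_iff.2 (by norm_num)
        have : (1 + 2 * √2.95 + 2.95) * (1 - q) ≤ 7.4 * (1 - q) :=
          mul_le_mul_of_nonneg_right (by linarith) hd.le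
        linarith
      · have hN4 : (4 : ℝ) ≤ N := by exact_mod_cast (by omega : 4 ≤ N)
        have hs : 2 * √(0.9 * N) ≤ 1 + 0.9 * N := by
          have := sq_sqrt (by positivity : 0 ≤ 0.9 * (N : ℝ))
          have := sq_nonneg (√(0.9 * N) - 1)
          linarith
        have : (1 + 2 * √(0.9 * N) + 0.9 * N) * (1 - q) ≤ 2.6 * N * (1 - q) :=
          mul_le_mul_of_nonneg_right (by linarith) hd.le
        linarith

/-- The univariate estimates behind the quadratic bound: an error constant `√(K q ^ N)` and an
interpolation constant `L` that are balanced so that they can be propagated over the coordinates. -/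
lemma exists_balanced_bounds (hϱ : 1 < ϱ) (hN : 1 ≤ N) {q : ℝ} (hq : q = (ϱ ^ 2)⁻¹) :
    ∃ K L : ℝ, 0 ≤ K ∧ 0 ≤ L ∧ ErrorBound ϱ N √(K * q ^ N) ∧ InterpBound ϱ N L ∧
      K ≤ 4 * (2 / (1 - q)) ∧ K * (1 - q) / 8 + L ^ 2 ≤ 2 / (1 - q) := by
  obtain ⟨hq0, hq1⟩ := inv_sq_pos_lt_one hϱ
  rw [← hq] at hq0 hq1
  have hd : 0 < 1 - q := by linarith
  have hd' : 1 - q ≠ 0 := hd.ne'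
  have hX0 : 0 < q ^ N := by positivity
  rcases le_or_gt (q ^ N) (1 / 4) with hX | hX
  · obtain ⟨L, hL0, hL, hL2⟩ := exists_interpBound_of_pow_le hϱ hN hq hX
    have hp : 0 < 1 + q := by linarith
    have hp' : 1 + q ≠ 0 := hp.ne'
    have e : 1 - q ^ 2 = (1 - q) * (1 + q) := by ring
    refine ⟨16 * (q / (1 - q ^ 2)), L, ?_, hL0, ?_, hL, ?_, ?_⟩
    · rw [e]; positivity
    · have hE := fun θ => aliasing_energy_le hN hq0 hq1 le_rfl
        (fun s hs => by nlinarith [mul_nonneg hs.1 (sub_nonneg.2 hs.2), sq_nonneg (1 - s)])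
        (by nlinarith) θ
      have := hE
      rw [hq] at this
      have := errorBound_of_energy hϱ hN this
      rw [← hq] at this
      convert this using 2
      ring
    · rw [e, ← mul_div_assoc, ← mul_div_assoc, div_le_div_iff₀ (by positivity) hd]
      nlinarith [mul_pos hd hd]
    · rw [e] at hL2 ⊢
      have e1 : 16 * (q / ((1 - q) * (1 + q))) * (1 - q) / 8 = 2 * q / (1 + q) := by
        field_simp; ring
      have e2 : 2 / (1 - q) = 2 * q / (1 + q) + 2 * (1 + q ^ 2) / ((1 - q) * (1 + q)) := by
        field_simp; ring
      rw [e1, e2]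
      linarith
  · obtain ⟨L, hL0, hL, hL2⟩ := exists_interpBound_of_lt_pow hϱ hN hq hX
    refine ⟨8 / (1 - q), L, by positivity, hL0, errorBound_of_lt_pow hϱ hN hq hX, hL, ?_, ?_⟩
    · exact le_of_eq (by ring)
    · rw [div_mul_cancel₀ _ hd']; linarith

end QuadraticPair

/-! ### Propagation over the variables -/

section Tensor

variable {ι : Type*} [DecidableEq ι]

/-- The product of the Bernstein ellipses of parameters `ϱ i`. -/
def polyEllipse (ϱ : ι → ℝ) : Set (ι → ℂ) := Set.univ.pi fun i => bernsteinEllipse (ϱ i)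

/-- `G` is holomorphic on `polyEllipse ϱ` in each variable separately. -/
def SepHolo (ϱ : ι → ℝ) (G : (ι → ℂ) → ℂ) : Prop :=
  ∀ z ∈ polyEllipse ϱ, ∀ i,
    DifferentiableOn ℂ (fun t => G (Function.update z i t)) (bernsteinEllipse (ϱ i))

/-- Substitution of the value `x` for the `i`-th variable. -/
def evalAt (i : ι) (x : ℂ) (G : (ι → ℂ) → ℂ) : (ι → ℂ) → ℂ :=
  fun z => G (Function.update z i x)

/-- Univariate interpolation of degree `N` in the `i`-th variable, evaluated at `y`. -/
def interpAt (i : ι) (N : ℕ) (y : ℝ) (G : (ι → ℂ) → ℂ) : (ι → ℂ) → ℂ :=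
  fun z => univInterp N (fun t => G (Function.update z i t)) y

/-- Evaluation at `y` in all variables of the list. -/
def evalList (y : ι → ℝ) : List ι → ((ι → ℂ) → ℂ) → (ι → ℂ) → ℂ
  | [], G => G
  | i :: l, G => evalAt i (y i) (evalList y l G)

/-- Interpolation, evaluated at `y`, in all variables of the list. -/
def interpList (N : ι → ℕ) (y : ι → ℝ) : List ι → ((ι → ℂ) → ℂ) → (ι → ℂ) → ℂ
  | [], G => G
  | i :: l, G => interpAt i (N i) (y i) (interpList N y l G)

/-- The propagation of univariate error constants `e` and interpolation constants `L` along a list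
of variables. -/
def errorRec (e L : ι → ℝ) : List ι → ℝ
  | [] => 0
  | i :: l => e i + L i * errorRec e L l

variable {ϱ : ι → ℝ}

lemma update_mem_polyEllipse {z : ι → ℂ} (hz : z ∈ polyEllipse ϱ) {i : ι} {t : ℂ}
    (ht : t ∈ bernsteinEllipse (ϱ i)) : Function.update z i t ∈ polyEllipse ϱ := by
  intro j _
  rcases eq_or_ne j i with rfl | h
  · simpa using ht
  · simpa [h] using hz j trivial

lemma SepHolo.sub {G H : (ι → ℂ) → ℂ} (hG : SepHolo ϱ G) (hH : SepHolo ϱ H) :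
    SepHolo ϱ (G - H) := fun z hz i => (hG z hz i).sub (hH z hz i)

lemma SepHolo.evalAt {G : (ι → ℂ) → ℂ} (hG : SepHolo ϱ G) {j : ι} {x : ℂ}
    (hx : x ∈ bernsteinEllipse (ϱ j)) : SepHolo ϱ (evalAt j x G) := by
  intro z hz i
  unfold ChebInterp.evalAt
  rcases eq_or_ne j i with rfl | h
  · simp only [Function.update_idem]
    exact differentiableOn_const _
  · simp_rw [Function.update_comm h.symm]
    exact hG _ (update_mem_polyEllipse hz hx) i

lemma SepHolo.interpAt (hϱ : ∀ i, 1 < ϱ i) {G : (ι → ℂ) → ℂ} (hG : SepHolo ϱ G) (j : ι) (N : ℕ)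
    (y : ℝ) : SepHolo ϱ (interpAt j N y G) := by
  intro z hz i
  unfold ChebInterp.interpAt univInterp
  refine DifferentiableOn.fun_sum fun k _ => DifferentiableOn.const_mul ?_ _
  exact hG.evalAt (ofReal_mem_bernsteinEllipse (hϱ j) (node_mem_Icc N k)) z hz i

lemma SepHolo.evalList (hϱ : ∀ i, 1 < ϱ i) {G : (ι → ℂ) → ℂ} (hG : SepHolo ϱ G) {y : ι → ℝ}
    (hy : ∀ i, y i ∈ Set.Icc (-1 : ℝ) 1) : ∀ l, SepHolo ϱ (evalList y l G)
  | [] => hG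
  | i :: l => (hG.evalList hϱ hy l).evalAt (ofReal_mem_bernsteinEllipse (hϱ i) (hy i))

lemma SepHolo.interpList (hϱ : ∀ i, 1 < ϱ i) {G : (ι → ℂ) → ℂ} (hG : SepHolo ϱ G) (N : ι → ℕ)
    (y : ι → ℝ) : ∀ l, SepHolo ϱ (interpList N y l G)
  | [] => hG
  | i :: l => (hG.interpList hϱ N y l).interpAt hϱ i _ _

lemma SepHolo.isBoundedHolo {G : (ι → ℂ) → ℂ} (hG : SepHolo ϱ G) {W : ℝ}
    (hW : ∀ z ∈ polyEllipse ϱ, ‖G z‖ ≤ W) {z : ι → ℂ} (hz : z ∈ polyEllipse ϱ) (i : ι) :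
    IsBoundedHolo (ϱ i) W (fun t => G (Function.update z i t)) :=
  ⟨hG z hz i, fun _ ht => hW _ (update_mem_polyEllipse hz ht)⟩

lemma evalList_eq (y : ι → ℝ) (G : (ι → ℂ) → ℂ) (l : List ι) (z : ι → ℂ) :
    evalList y l G z = G (fun i => if i ∈ l then (y i : ℂ) else z i) := by
  induction l generalizing z with
  | nil => simp [evalList]
  | cons i l ih =>
    simp only [evalList, evalAt, ih]
    congr 1
    ext j
    rcases eq_or_ne j i with rfl | h
    · simp
    · simp [h]

lemma norm_evalList_le (hϱ : ∀ i, 1 < ϱ i) {G : (ι → ℂ) → ℂ} {V : ℝ}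
    (hV : ∀ z ∈ polyEllipse ϱ, ‖G z‖ ≤ V) {y : ι → ℝ} (hy : ∀ i, y i ∈ Set.Icc (-1 : ℝ) 1)
    (l : List ι) {z : ι → ℂ} (hz : z ∈ polyEllipse ϱ) : ‖evalList y l G z‖ ≤ V := by
  rw [evalList_eq]
  refine hV _ fun i _ => ?_
  dsimp only
  split_ifs
  · exact ofReal_mem_bernsteinEllipse (hϱ i) (hy i)
  · exact hz i trivial

lemma univInterp_sub (N : ℕ) (g h : ℂ → ℂ) (y : ℝ) :
    univInterp N (fun t => g t - h t) y = univInterp N g y - univInterp N h y := by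
  simp only [univInterp, mul_sub, Finset.sum_sub_distrib]

/-- The error of interpolating in several variables: in each step,
`E_i E_l - T_i T_l = (E_i - T_i) E_l + T_i (E_l - T_l)` for the evaluations `E` and the
interpolations `T`. -/
theorem norm_evalList_sub_interpList_le (hϱ : ∀ i, 1 < ϱ i) {N : ι → ℕ} {e L : ι → ℝ}
    (he : ∀ i, ErrorBound (ϱ i) (N i) (e i)) (hL : ∀ i, InterpBound (ϱ i) (N i) (L i))
    {G : (ι → ℂ) → ℂ} {V : ℝ} (hG : SepHolo ϱ G) (hV : ∀ z ∈ polyEllipse ϱ, ‖G z‖ ≤ V)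
    {y : ι → ℝ} (hy : ∀ i, y i ∈ Set.Icc (-1 : ℝ) 1) (l : List ι) :
    ∀ z ∈ polyEllipse ϱ, ‖evalList y l G z - interpList N y l G z‖ ≤ errorRec e L l * V := by
  induction l with
  | nil => intro z _; simp [evalList, interpList, errorRec]
  | cons i l ih =>
    intro z hz
    have h1 := he i _ V ((hG.evalList hϱ hy l).isBoundedHolo
      (fun z hz => norm_evalList_le hϱ hV hy l hz) hz i) (y i) (hy i)
    have h2 := hL i _ _ (((hG.evalList hϱ hy l).sub (hG.interpList hϱ N y l)).isBoundedHolo ih hz i)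
      (y i) (hy i)
    simp only [Pi.sub_apply, univInterp_sub] at h2
    simp only [evalList, interpList, errorRec, evalAt, interpAt]
    refine (norm_sub_le_norm_sub_add_norm_sub _ _ _).trans ((add_le_add h1 h2).trans (le_of_eq ?_))
    ring

end Tensor

section Grid

variable {D : ℕ} (N : Fin D → ℕ)

lemma mem_multiIndex {k : Fin D → ℕ} : k ∈ multiIndex N ↔ ∀ i, k i ∈ range (N i + 1) := by
  simp [multiIndex]

/-- The point of the Chebyshev grid with multi-index `k`. -/
def gridPoint (k : Fin D → ℕ) : Fin D → ℂ := fun i => (node (N i) (k i) : ℂ)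

/-- The matrix entry, between grid indices, of interpolation in the variables of the list: a
Kronecker symbol in all other variables. -/
def gridWeight (y : Fin D → ℝ) (l : List (Fin D)) (i : Fin D) (k k' : ℕ) : ℂ :=
  if i ∈ l then (cardinal (N i) k' (y i) : ℂ) else if k = k' then 1 else 0

lemma update_gridPoint (k : Fin D → ℕ) (i : Fin D) (m : ℕ) :
    Function.update (gridPoint N k) i (node (N i) m : ℂ) =
      gridPoint N (Function.update k i m) := by
  ext j
  rcases eq_or_ne j i with rfl | h
  · simp [gridPoint]
  · simp [gridPoint, h]

lemma interpList_gridPoint (y : Fin D → ℝ) (G : (Fin D → ℂ) → ℂ) {l : List (Fin D)}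
    (hl : l.Nodup) : ∀ k ∈ multiIndex N, interpList N y l G (gridPoint N k) =
      ∑ k' ∈ multiIndex N, (∏ i, gridWeight N y l i (k i) (k' i)) * G (gridPoint N k') := by
  induction l with
  | nil =>
    intro k hk
    rw [Finset.sum_eq_single_of_mem k hk]
    · simp [gridWeight, interpList]
    · intro k' _ hne
      obtain ⟨i, hi⟩ := Function.ne_iff.1 hne
      rw [Finset.prod_eq_zero (Finset.mem_univ i), zero_mul]
      simp [gridWeight, hi.symm]
  | cons i l ih =>
    intro k hk
    obtain ⟨hil, hl⟩ := List.nodup_cons.1 hl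
    simp only [interpList, interpAt, univInterp, update_gridPoint]
    have hstep : ∀ m ∈ range (N i + 1), (cardinal (N i) m (y i) : ℂ) *
        interpList N y l G (gridPoint N (Function.update k i m)) =
        ∑ k' ∈ multiIndex N, (if m = k' i then (cardinal (N i) m (y i) : ℂ) else 0) *
          (∏ j ∈ univ.erase i, gridWeight N y l j (k j) (k' j)) * G (gridPoint N k') := by
      intro m hm
      have hmem : Function.update k i m ∈ multiIndex N := by
        rw [mem_multiIndex] at hk ⊢
        intro j
        rcases eq_or_ne j i with rfl | h
        · simpa using hm
        · simpa [h] using hk j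
      rw [ih hl _ hmem, Finset.mul_sum]
      refine Finset.sum_congr rfl fun k' _ => ?_
      rw [← Finset.mul_prod_erase univ _ (Finset.mem_univ i)]
      have : ∏ j ∈ univ.erase i, gridWeight N y l j (Function.update k i m j) (k' j) =
          ∏ j ∈ univ.erase i, gridWeight N y l j (k j) (k' j) := by
        refine Finset.prod_congr rfl fun j hj => ?_
        rw [Function.update_of_ne (Finset.ne_of_mem_erase hj)]
      rw [this, Function.update_self, gridWeight, if_neg hil]
      split_ifs <;> ring
    rw [Finset.sum_congr rfl hstep, Finset.sum_comm]
    refine Finset.sum_congr rfl fun k' hk' => ?_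
    rw [← Finset.sum_mul, ← Finset.sum_mul, Finset.sum_ite_eq',
      if_pos ((mem_multiIndex N).1 hk' i), ← Finset.mul_prod_erase univ _ (Finset.mem_univ i)]
    congr 2
    · simp [gridWeight]
    · refine Finset.prod_congr rfl fun j hj => ?_
      simp [gridWeight, Finset.ne_of_mem_erase hj]

lemma interpRef_eq (g : (Fin D → ℝ) → ℝ) (y : Fin D → ℝ) :
    interpRef N g y = ∑ k ∈ multiIndex N,
      (∏ i, cardinal (N i) (k i) (y i)) * g (fun i => node (N i) (k i)) := by
  unfold interpRef coeff
  simp_rw [Finset.mul_sum, Finset.sum_mul]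
  rw [Finset.sum_comm]
  refine Finset.sum_congr rfl fun k _ => ?_
  unfold cardinal
  rw [Finset.prod_mul_distrib, Finset.prod_univ_sum, Finset.mul_sum, Finset.sum_mul]
  refine Finset.sum_congr rfl fun j _ => ?_
  simp only [Finset.prod_mul_distrib]
  ring

/-- Interpolating one variable after the other yields the tensorized interpolation. -/
lemma interpList_eq_interpRef {g : (Fin D → ℝ) → ℝ} {G : (Fin D → ℂ) → ℂ}
    (hg : ∀ y : Fin D → ℝ, (∀ i, y i ∈ Set.Icc (-1 : ℝ) 1) → G (fun i => (y i : ℂ)) = (g y : ℂ))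
    (y : Fin D → ℝ) {l : List (Fin D)} (hl : l.Nodup) (hall : ∀ i, i ∈ l) :
    interpList N y l G (gridPoint N 0) = (interpRef N g y : ℂ) := by
  rw [interpList_gridPoint N y G hl 0 (by simp [mem_multiIndex]), interpRef_eq]
  push_cast
  refine Finset.sum_congr rfl fun k _ => ?_
  rw [← hg _ fun i => node_mem_Icc _ _]
  simp only [gridWeight, hall, if_true]
  rfl

end Grid

/-! ### The two bounds -/

section Recursion

lemma errorRec_ofFn {ι : Type*} [DecidableEq ι] (e L : ι → ℝ) {n : ℕ} (s : Fin n → ι) :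
    errorRec e L (List.ofFn s) = ∑ k, e (s k) * ∏ j ∈ univ.filter (· < k), L (s j) := by
  induction n with
  | zero => simp [errorRec]
  | succ n ih =>
    rw [List.ofFn_succ, errorRec, ih, Fin.sum_univ_succ, Finset.mul_sum]
    congr 1
    · simp
    · refine Finset.sum_congr rfl fun k _ => ?_
      simp only [Finset.prod_filter, Fin.prod_univ_succ, Fin.succ_lt_succ_iff, Fin.succ_pos,
        if_true]
      ring

/-- Prepending one variable to a list: Cauchy–Schwarz for the pairs `(√K, 2 L √P)` and `(√X, √S)`. -/
lemma sqrt_add_mul_sq_le {K X L B c P S : ℝ} (hK : 0 ≤ K) (hX : 0 ≤ X) (hL : 0 ≤ L) (hB : 0 ≤ B)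
    (hP : 0 ≤ P) (hS : 0 ≤ S) (hBP : B ^ 2 ≤ 4 * P * S) (hKL : K + 4 * L ^ 2 * P ≤ 4 * c * P) :
    (√(K * X) + L * B) ^ 2 ≤ 4 * (c * P) * (X + S) := by
  have hB' : B ≤ √(4 * P * S) := le_sqrt_of_sq_le hBP
  have h1 : √(K * X) + L * B ≤ √K * √X + (2 * L * √P) * √S := by
    rw [sqrt_mul hK, mul_assoc 4, sqrt_mul (by norm_num), sqrt_mul hP,
      show (4 : ℝ) = 2 ^ 2 by norm_num, sqrt_sq (by norm_num)] at *
    have := mul_le_mul_of_nonneg_left hB' hL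
    linarith
  have h2 : (√K * √X + (2 * L * √P) * √S) ^ 2 ≤ (K + 4 * L ^ 2 * P) * (X + S) := by
    have e1 := sq_sqrt hK
    have e2 := sq_sqrt hX
    have e3 := sq_sqrt hP
    have e4 := sq_sqrt hS
    have : (K + 4 * L ^ 2 * P) * (X + S) - (√K * √X + (2 * L * √P) * √S) ^ 2 =
        (√K * √S - 2 * L * √P * √X) ^ 2 := by
      nth_rewrite 1 [← e1, ← e2, ← e3, ← e4]
      ring
    nlinarith [sq_nonneg (√K * √S - 2 * L * √P * √X)]
  calc (√(K * X) + L * B) ^ 2 ≤ (√K * √X + (2 * L * √P) * √S) ^ 2 := by gcongr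
    _ ≤ _ := h2
    _ ≤ 4 * c * P * (X + S) := by gcongr
    _ = _ := by ring

/-- Along a list of variables with increasing `c i`, balanced univariate bounds propagate to the
quadratic bound. The order matters: it makes the product of the later `c j` at least `c i`, so that
`K i` is absorbed. In the application, `c i = 2 / (1 - q i)` and `X i = q i ^ N i`. -/
lemma errorRec_sq_le {ι : Type*} [DecidableEq ι] {K L X c : ι → ℝ} (hK : ∀ i, 0 ≤ K i)
    (hL : ∀ i, 0 ≤ L i) (hX : ∀ i, 0 ≤ X i) (hc : ∀ i, 1 ≤ c i) (hKc : ∀ i, K i ≤ 4 * c i)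
    (hKL : ∀ i, K i / (4 * c i) + L i ^ 2 ≤ c i) (l : List ι) :
    ∀ i, (i :: l).Pairwise (fun i j => c i ≤ c j) →
      0 ≤ errorRec (fun i => √(K i * X i)) L (i :: l) ∧ c i ≤ ((i :: l).map c).prod ∧
      errorRec (fun i => √(K i * X i)) L (i :: l) ^ 2 ≤
        4 * ((i :: l).map c).prod * ((i :: l).map X).sum := by
  induction l with
  | nil =>
    intro i _
    have h := mul_le_mul_of_nonneg_right (hKc i) (hX i)
    simp only [errorRec, List.map_cons, List.map_nil, List.prod_cons, List.prod_nil, mul_one,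
      List.sum_cons, List.sum_nil, add_zero, mul_zero, sq_sqrt (mul_nonneg (hK i) (hX i)), le_refl,
      true_and]
    exact ⟨sqrt_nonneg _, h⟩
  | cons j l ih =>
    intro i hp
    obtain ⟨hi, hp'⟩ := List.pairwise_cons.1 hp
    obtain ⟨h0, h1, h2⟩ := ih j hp'
    have hij : c i ≤ ((j :: l).map c).prod := (hi j (by simp)).trans h1
    have hP1 : 1 ≤ ((j :: l).map c).prod := (hc i).trans hij
    have hS : 0 ≤ ((j :: l).map X).sum :=
      List.sum_nonneg (by simpa using ⟨hX j, fun a _ => hX a⟩)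
    have hci : 0 < c i := lt_of_lt_of_le one_pos (hc i)
    rw [errorRec, List.map_cons, List.map_cons (f := X), List.prod_cons, List.sum_cons]
    generalize errorRec (fun i => √(K i * X i)) L (j :: l) = B at *
    generalize ((j :: l).map c).prod = P at *
    generalize ((j :: l).map X).sum = S at *
    refine ⟨add_nonneg (sqrt_nonneg _) (mul_nonneg (hL i) h0), ?_, ?_⟩
    · exact le_mul_of_one_le_right hci.le hP1
    · refine sqrt_add_mul_sq_le (hK i) (hX i) (hL i) h0 (by linarith) hS h2 ?_
      have h3 : K i ≤ 4 * P * (K i / (4 * c i)) := by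
        rw [← mul_div_assoc, le_div_iff₀ (by positivity)]
        have := mul_le_mul_of_nonneg_left hij (hK i)
        linarith
      have h4 := mul_le_mul_of_nonneg_left (hKL i) (by linarith : 0 ≤ 4 * P)
      linarith

end Recursion

section Bounds

variable {D : ℕ} {ϱ : Fin D → ℝ} {N : Fin D → ℕ} {V : ℝ}

/-- The term of position `k` is bounded without the factor `k + 2 ^ k - 1 ≥ 1` of `boundPerm`. -/
lemma errorRec_le_boundPerm (hϱ : ∀ i, 1 < ϱ i) (hV : 0 ≤ V) (σ : Equiv.Perm (Fin D)) :
    errorRec (fun i => 4 * (ϱ i ^ (-(N i : ℤ)) / (ϱ i - 1))) (fun i => 2 / (1 - 1 / ϱ i))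
      (List.ofFn σ) * V ≤ boundPerm V ϱ N σ := by
  have hd : ∀ i, 0 < 1 - 1 / ϱ i := fun i => by
    have := (div_lt_one (by linarith [hϱ i])).2 (hϱ i)
    linarith
  rw [errorRec_ofFn, boundPerm, Finset.sum_filter, ← Finset.sum_add_distrib, Finset.sum_mul]
  refine Finset.sum_le_sum fun k _ => ?_
  have hcard : (univ.filter (· < k)).card = (k : ℕ) := by
    rw [Finset.filter_gt_eq_Iio, Fin.card_Iio]
  rw [Finset.prod_div_distrib, Finset.prod_const, hcard]
  have he : 0 ≤ 4 * V * (ϱ (σ k) ^ (-(N (σ k) : ℤ)) / (ϱ (σ k) - 1)) := by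
    have : 0 < ϱ (σ k) - 1 := by linarith [hϱ (σ k)]
    have : 0 < ϱ (σ k) := by linarith
    positivity
  have hprod : 0 < ∏ j ∈ univ.filter (· < k), (1 - 1 / ϱ (σ j)) := Finset.prod_pos fun j _ => hd _
  have hempty : (k : ℕ) = 0 → ∏ j ∈ univ.filter (· < k), (1 - 1 / ϱ (σ j)) = 1 := by
    intro h0
    refine Finset.prod_eq_one fun j hj => ?_
    have := Fin.lt_def.1 (Finset.mem_filter.1 hj).2
    omega
  generalize ∏ j ∈ univ.filter (· < k), (1 - 1 / ϱ (σ j)) = p at *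
  generalize ϱ (σ k) ^ (-(N (σ k) : ℤ)) / (ϱ (σ k) - 1) = ε at *
  rcases Nat.eq_zero_or_pos (k : ℕ) with h0 | h0
  · rw [if_neg (by omega), h0]
    rw [hempty h0]
    linarith
  · rw [if_pos (show 1 ≤ (k : ℕ) from h0)]
    have h1 : (1 : ℝ) ≤ (k : ℝ) + 2 ^ (k : ℕ) - 1 := by
      have : (1 : ℝ) ≤ 2 ^ (k : ℕ) := one_le_pow₀ one_le_two
      have : (1 : ℝ) ≤ (k : ℕ) := by exact_mod_cast h0
      linarith
    have h2 : 4 * V * ε * 2 ^ (k : ℕ) * (1 / p) ≤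
        4 * V * ε * 2 ^ (k : ℕ) * (((k : ℝ) + 2 ^ (k : ℕ) - 1) / p) := by
      gcongr
    have h3 : 4 * ε * (2 ^ (k : ℕ) / p) * V = 4 * V * ε * 2 ^ (k : ℕ) * (1 / p) := by ring
    linarith

/-- The variables are ordered by increasing `q i`, that is, by decreasing `ϱ i`. -/
lemma exists_errorRec_le_boundB (hϱ : ∀ i, 1 < ϱ i) (hN : ∀ i, 1 ≤ N i) (hV : 0 ≤ V) :
    ∃ (e L : Fin D → ℝ) (σ : Equiv.Perm (Fin D)), (∀ i, ErrorBound (ϱ i) (N i) (e i)) ∧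
      (∀ i, InterpBound (ϱ i) (N i) (L i)) ∧ errorRec e L (List.ofFn σ) * V ≤ boundB V ϱ N := by
  choose K L hK hL he hI hKc hKL using fun i => exists_balanced_bounds (hϱ i) (hN i) rfl
  set q : Fin D → ℝ := fun i => (ϱ i ^ 2)⁻¹ with hq
  set c : Fin D → ℝ := fun i => 2 / (1 - q i) with hc
  have hq01 : ∀ i, 0 < q i ∧ q i < 1 := fun i => inv_sq_pos_lt_one (hϱ i)
  have hq' : ∀ i, 0 < 1 - q i := fun i => by linarith [(hq01 i).2]
  have hc1 : ∀ i, 1 ≤ c i := fun i => by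
    rw [hc]; dsimp only; rw [le_div_iff₀ (hq' i)]; linarith [(hq01 i).1]
  have hX0 : ∀ i, 0 ≤ q i ^ N i := fun i => pow_nonneg (hq01 i).1.le _
  refine ⟨fun i => √(K i * q i ^ N i), L, Tuple.sort c, he, hI, ?_⟩
  have hmain : errorRec (fun i => √(K i * q i ^ N i)) L (List.ofFn (Tuple.sort c)) ^ 2 ≤
      4 * (∏ i, c i) * ∑ i, q i ^ N i := by
    have hpw : (List.ofFn (Tuple.sort c)).Pairwise (fun i j => c i ≤ c j) :=
      List.pairwise_ofFn.2 fun i j hij => Tuple.monotone_sort c hij.le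
    have hprod : ((List.ofFn (Tuple.sort c)).map c).prod = ∏ i, c i := by
      rw [List.map_ofFn, List.prod_ofFn]
      exact Equiv.prod_comp (Tuple.sort c) c
    have hsum : ((List.ofFn (Tuple.sort c)).map (fun i => q i ^ N i)).sum = ∑ i, q i ^ N i := by
      rw [List.map_ofFn, List.sum_ofFn]
      exact Equiv.sum_comp (Tuple.sort c) (fun i => q i ^ N i)
    rw [← hprod, ← hsum]
    generalize List.ofFn (Tuple.sort c) = l at hpw
    cases l with
    | nil => simp [errorRec]
    | cons i l =>
      refine (errorRec_sq_le hK hL hX0 hc1 hKc (fun i => ?_) l i hpw).2.2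
      have h1 : K i / (4 * c i) = K i * (1 - q i) / 8 := by
        have := (hq' i).ne'
        simp only [hc]
        field_simp
        ring
      rw [h1]
      exact hKL i
  have hz1 : ∀ i, ϱ i ^ (-(2 * (N i : ℤ))) = q i ^ N i := fun i => by
    rw [hq, zpow_neg, zpow_mul, zpow_natCast, inv_pow]
    norm_cast
  have hz2 : ∀ i, ϱ i ^ (-2 : ℤ) = q i := fun i => by
    rw [hq, zpow_neg]
    norm_cast
  have hb : boundB V ϱ N = (2 : ℝ) ^ ((D : ℝ) / 2 + 1) *
      √((∑ i, q i ^ N i) * ∏ j, 1 / (1 - q j)) * V := by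
    rw [boundB]
    simp_rw [hz1, hz2]
    rw [Finset.sum_mul]
    ring
  rw [hb]
  refine mul_le_mul_of_nonneg_right (le_of_sq_le_sq (hmain.trans (le_of_eq ?_)) (by positivity)) hV
  have hnn : 0 ≤ (∑ i, q i ^ N i) * ∏ j, 1 / (1 - q j) :=
    mul_nonneg (Finset.sum_nonneg fun i _ => hX0 i)
      (Finset.prod_nonneg fun j _ => (one_div_pos.2 (hq' j)).le)
  have h2 : ((2 : ℝ) ^ ((D : ℝ) / 2 + 1)) ^ 2 = 4 * 2 ^ D := by
    rw [← rpow_natCast, ← rpow_mul zero_le_two, ← rpow_natCast,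
      show ((D : ℝ) / 2 + 1) * (2 : ℕ) = D + 2 by push_cast; ring, rpow_add two_pos]
    norm_num
    ring
  have h3 : ∏ i, c i = 2 ^ D * ∏ j, 1 / (1 - q j) := by
    have : ∀ i, c i = 2 * (1 / (1 - q i)) := fun i => by simp only [hc]; ring
    simp_rw [this]
    rw [Finset.prod_mul_distrib]
    simp
  rw [mul_pow, sq_sqrt hnn, h2, h3]
  ring

end Bounds

/-! ### Transport to the hyperrectangle -/

section Transport

variable {D : ℕ} {lo hi ϱ : Fin D → ℝ}

lemma fromRef_toRef (hlohi : ∀ i, lo i < hi i) (x : Fin D → ℝ) :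
    fromRef lo hi (toRef lo hi x) = x := by
  ext i
  have : hi i - lo i ≠ 0 := by linarith [hlohi i]
  simp only [fromRef, toRef]
  field_simp
  ring

lemma fromRef_mem_Icc (hlohi : ∀ i, lo i < hi i) {y : Fin D → ℝ}
    (hy : ∀ i, y i ∈ Set.Icc (-1 : ℝ) 1) : fromRef lo hi y ∈ Set.Icc lo hi := by
  refine ⟨fun i => ?_, fun i => ?_⟩ <;> simp only [fromRef]
  · nlinarith [hlohi i, (hy i).1]
  · nlinarith [hlohi i, (hy i).2]

lemma toRef_mem_Icc (hlohi : ∀ i, lo i < hi i) {x : Fin D → ℝ} (hx : x ∈ Set.Icc lo hi)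
    (i : Fin D) : toRef lo hi x i ∈ Set.Icc (-1 : ℝ) 1 := by
  have h : 0 < hi i - lo i := by linarith [hlohi i]
  have h1 := hx.1 i
  have h2 := hx.2 i
  simp only [toRef]
  constructor
  · rw [neg_le_sub_iff_le_add, div_le_iff₀ h]; linarith
  · rw [sub_le_self_iff]
    exact div_nonneg (by linarith) h.le

lemma affineC_ofReal (y : Fin D → ℝ) (i : Fin D) :
    affineC (lo i) (hi i) (y i : ℂ) = (fromRef lo hi y i : ℂ) := by
  simp only [affineC, fromRef]
  push_cast
  ring

lemma affineC_mem_genBernstein {w : Fin D → ℂ} (hw : w ∈ polyEllipse ϱ) :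
    (fun i => affineC (lo i) (hi i) (w i)) ∈ genBernstein lo hi ϱ :=
  fun i _ => ⟨w i, hw i trivial, rfl⟩

lemma ofReal_mem_genBernstein (hlohi : ∀ i, lo i < hi i) (hϱ : ∀ i, 1 < ϱ i) {x : Fin D → ℝ}
    (hx : x ∈ Set.Icc lo hi) : (fun i => (x i : ℂ)) ∈ genBernstein lo hi ϱ := by
  rw [← fromRef_toRef hlohi x]
  simp_rw [← affineC_ofReal]
  exact affineC_mem_genBernstein fun i _ =>
    ofReal_mem_bernsteinEllipse (hϱ i) (toRef_mem_Icc hlohi hx i)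

lemma sepHolo_comp_affineC {F : (Fin D → ℂ) → ℂ} (hF : AnalyticOnNhd ℂ F (genBernstein lo hi ϱ)) :
    SepHolo ϱ (fun w => F (fun i => affineC (lo i) (hi i) (w i))) := by
  intro z hz i t ht
  have h1 := (hF _ (affineC_mem_genBernstein (update_mem_polyEllipse hz ht))).differentiableAt
  refine DifferentiableAt.differentiableWithinAt (h1.comp t ?_)
  rw [differentiableAt_pi]
  intro j
  rcases eq_or_ne j i with rfl | h
  · simp only [Function.update_self, affineC]
    fun_prop
  · simp only [Function.update_of_ne h]
    exact differentiableAt_const _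

lemma abs_sub_interp_le (hlohi : ∀ i, lo i < hi i) (hϱ : ∀ i, 1 < ϱ i) {N : Fin D → ℕ}
    {f : (Fin D → ℝ) → ℝ} {F : (Fin D → ℂ) → ℂ} {V : ℝ}
    (hF : AnalyticOnNhd ℂ F (genBernstein lo hi ϱ))
    (hext : ∀ x ∈ Set.Icc lo hi, F (fun i => (x i : ℂ)) = (f x : ℂ))
    (hV : ∀ z ∈ genBernstein lo hi ϱ, ‖F z‖ ≤ V) {e L : Fin D → ℝ}
    (he : ∀ i, ErrorBound (ϱ i) (N i) (e i)) (hL : ∀ i, InterpBound (ϱ i) (N i) (L i))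
    (σ : Equiv.Perm (Fin D)) {x : Fin D → ℝ} (hx : x ∈ Set.Icc lo hi) :
    |f x - interp lo hi N f x| ≤ errorRec e L (List.ofFn σ) * V := by
  set y := toRef lo hi x with hy
  have hy1 : ∀ i, y i ∈ Set.Icc (-1 : ℝ) 1 := toRef_mem_Icc hlohi hx
  set G : (Fin D → ℂ) → ℂ := fun w => F (fun i => affineC (lo i) (hi i) (w i)) with hG
  have hg : ∀ y : Fin D → ℝ, (∀ i, y i ∈ Set.Icc (-1 : ℝ) 1) →
      G (fun i => (y i : ℂ)) = (f (fromRef lo hi y) : ℂ) := by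
    intro y hy
    rw [hG, ← hext _ (fromRef_mem_Icc hlohi hy)]
    simp_rw [affineC_ofReal]
  have hall : ∀ i, i ∈ List.ofFn σ := fun i => by
    rw [List.mem_ofFn]; exact σ.surjective i
  have hnd : (List.ofFn σ).Nodup := List.nodup_ofFn.2 σ.injective
  have h := norm_evalList_sub_interpList_le hϱ he hL (sepHolo_comp_affineC hF)
    (fun w hw => hV _ (affineC_mem_genBernstein hw)) hy1 (List.ofFn σ) (gridPoint N 0)
    (fun i _ => ofReal_mem_bernsteinEllipse (hϱ i) (node_mem_Icc _ _))
  rw [interpList_eq_interpRef N hg y hnd hall, evalList_eq] at h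
  simp only [hall, if_true] at h
  have hgy : F (fun i => affineC (lo i) (hi i) (y i)) = (f x : ℂ) := by
    rw [← fromRef_toRef hlohi x]; exact hg y hy1
  rw [hgy, ← Complex.ofReal_sub, Complex.norm_real, norm_eq_abs] at h
  exact h

lemma continuous_interp (N : Fin D → ℕ) (f : (Fin D → ℝ) → ℝ) : Continuous (interp lo hi N f) := by
  unfold interp interpRef toRef
  fun_prop

end Transport

end ChebInterp

end

theorem theorem1 (D : ℕ) (lo hi : Fin D → ℝ) (hlohi : ∀ i, lo i < hi i)
    (ϱ : Fin D → ℝ) (hϱ : ∀ i, 1 < ϱ i) (N : Fin D → ℕ) (hN : ∀ i, 1 ≤ N i)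
    (f : (Fin D → ℝ) → ℝ) (F : (Fin D → ℂ) → ℂ) (V : ℝ)
    (hF : AnalyticOnNhd ℂ F (ChebInterp.genBernstein lo hi ϱ))
    (hext : ∀ x ∈ Set.Icc lo hi, F (fun i => (x i : ℂ)) = (f x : ℂ))
    (hV : ∀ z ∈ ChebInterp.genBernstein lo hi ϱ, ‖F z‖ ≤ V) :
    ∃ M : ℝ,
      IsGreatest ((fun x => |f x - ChebInterp.interp lo hi N f x|) '' Set.Icc lo hi) M ∧
        M ≤ min (ChebInterp.boundA V ϱ N) (ChebInterp.boundB V ϱ N) := by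
  have hlo : lo ∈ Set.Icc lo hi := Set.left_mem_Icc.2 fun i => (hlohi i).le
  have hV0 : 0 ≤ V :=
    (norm_nonneg _).trans (hV _ (ChebInterp.ofReal_mem_genBernstein hlohi hϱ hlo))
  have hfc : ContinuousOn f (Set.Icc lo hi) := by
    have h1 : ContinuousOn (fun x : Fin D → ℝ => F (fun i => (x i : ℂ))) (Set.Icc lo hi) :=
      hF.continuousOn.comp (by fun_prop)
        fun x hx => ChebInterp.ofReal_mem_genBernstein hlohi hϱ hx
    refine (Complex.continuous_re.comp_continuousOn h1).congr fun x hx => ?_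
    simp [hext x hx]
  obtain ⟨x, hx, hmax⟩ := isCompact_Icc.exists_isMaxOn ⟨lo, hlo⟩
    (hfc.sub (ChebInterp.continuous_interp (lo := lo) (hi := hi) N f).continuousOn).abs
  refine ⟨_, ⟨⟨x, hx, rfl⟩, ?_⟩, le_min ?_ ?_⟩
  · rintro _ ⟨z, hz, rfl⟩
    exact hmax hz
  · refine Finset.le_inf' _ _ fun σ _ => ?_
    exact (ChebInterp.abs_sub_interp_le hlohi hϱ hF hext hV
      (fun i => ChebInterp.errorBound_geometric (hϱ i) (hN i))
      (fun i => ChebInterp.interpBound_geometric (hϱ i) (hN i)) σ hx).trans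
        (ChebInterp.errorRec_le_boundPerm hϱ hV0 σ)
  · obtain ⟨e, L, σ, he, hL, h⟩ := ChebInterp.exists_errorRec_le_boundB hϱ hN hV0
    exact (ChebInterp.abs_sub_interp_le hlohi hϱ hF hext hV he hL σ hx).trans h
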